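/- Let $(M,g)$ be a smooth Riemannian manifold (Hausdorff, second countable, without boundary, of dimension $n+1$). A *rigid flow* on $M$ is a smooth unit vector field $u$ such that every point of $M$ has an open neighbourhood on which some smooth submersion onto an open subset of an $n$-dimensional Riemannian manifold has fibres tangent to $u$ and is a Riemannian submersion, i.e. its differential is isometric on $u^\perp$. An *adapted frame* at $p$ is an orthonormal frame $(e_0,e_1,\dots,e_n)$ of $T_pM$ with $e_0=u(p)$. With the Levi-Civita connection $\nabla$, put, for $1\le i,j\le n$, $$M_{ij}=-g(\nabla_{e_j}u,e_i),\qquad K_i=-g(\nabla_u u,e_i),$$ so that the connection form satisfies $\omega^0{}_i=M_{ij}\theta^j+K_i\psi$, where $(\psi,\theta^1,\dots,\theta^n)$ is the dual coframe. $M_{ij}$ and $K_i$ are functions on the set of adapted frames. That two flows $u,u'$ have the same $M_{ij}$ (the same $K_i$) over a set $S\subset M$ means that $u=u'$ on $S$, so that the adapted frames over $S$ are the same, and that the functions $M_{ij}$ (the functions $K_i$) of the two flows agree on all adapted frames at points of $S$. The flow is *rotational* at $p$ if some $M_{ij}$ is nonzero at $p$ (we write $M\neq 0$ at $p$). Let $u,u'$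 be two rigid flows on the same $(M,g)$, let $T\subset M$ be a smooth embedded hypersurface transversal to both flows, and suppose that $u$ and $u'$ have the same $M_{ij}$ over $T$. 1. If $u$ is rotational at every point of $M$ and every connected component of $M$ meets $T$ (for instance, if every flow line of $u$ meets $T$, or if $M$ is connected and $T\ne\emptyset$), then $u$ and $u'$ have the same $M_{ij}$ over all of $M$. 2. If $O\subset M$ is any open set with $T\subset O$, such that $u$ has $M\neq 0$ at every point of $O$ and every connected component of $O$ meets $T$, then $u$ and $u'$ have the same $M_{ij}$ and the same $K_i$ over $O$. In other words, the values of $M_{ij}$ on $T$ determine $M_{ij}$ and $K_i$ throughout. No such non-vanishing is assumed of $u'$. -/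

import Mathlib

open Bundle Manifold VectorField
open scoped ContDiff Topology

noncomputable section

/-! ### Covariant derivatives on a Riemannian manifold

Throughout, `M` is a smooth manifold of dimension `n + 1` whose tangent spaces carry a Riemannian
metric `inner ℝ`. -/

/-- The number `g(∇_v Z, w)` at the point `p`, where `∇` is the Levi-Civita connection, given by
Koszul's formula. The tangent vectors `v`, `w` at `p` are extended to vector fields that are smooth
near `p`; the result does not depend on the extension. -/
def leviCivitaInner {n : ℕ} {M : Type*} [TopologicalSpace M]
    [ChartedSpace (EuclideanSpace ℝ (Fin (n + 1))) M] [IsManifold (𝓡 (n + 1)) ∞ M]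
    [RiemannianBundle (fun x : M => TangentSpace (𝓡 (n + 1)) x)]
    (Z : ∀ x : M, TangentSpace (𝓡 (n + 1)) x) (p : M) (v w : TangentSpace (𝓡 (n + 1)) p) : ℝ :=
  let X : ∀ x : M, TangentSpace (𝓡 (n + 1)) x :=
    FiberBundle.extend (EuclideanSpace ℝ (Fin (n + 1))) v
  let Y : ∀ x : M, TangentSpace (𝓡 (n + 1)) x :=
    FiberBundle.extend (EuclideanSpace ℝ (Fin (n + 1))) w
  (1 / 2) *
    (mvfderiv (𝓡 (n + 1)) (fun x => inner ℝ (Z x) (Y x)) p v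
      + mvfderiv (𝓡 (n + 1)) (fun x => inner ℝ (X x) (Y x)) p (Z p)
      - mvfderiv (𝓡 (n + 1)) (fun x => inner ℝ (X x) (Z x)) p w
      + inner ℝ (mlieBracket (𝓡 (n + 1)) X Z p) w
      - inner ℝ (mlieBracket (𝓡 (n + 1)) Z Y p) v
      - inner ℝ (mlieBracket (𝓡 (n + 1)) X Y p) (Z p))

/-- `leviCivitaInner` is computed by every torsion-free metric connection. -/
theorem leviCivitaInner_eq {n : ℕ} {M : Type*} [TopologicalSpace M]
    [ChartedSpace (EuclideanSpace ℝ (Fin (n + 1))) M] [IsManifold (𝓡 (n + 1)) ∞ M]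
    [RiemannianBundle (fun x : M => TangentSpace (𝓡 (n + 1)) x)]
    [IsContMDiffRiemannianBundle (𝓡 (n + 1)) 1 (EuclideanSpace ℝ (Fin (n + 1)))
      (fun x : M => TangentSpace (𝓡 (n + 1)) x)]
    (cov : CovariantDerivative (𝓡 (n + 1)) (EuclideanSpace ℝ (Fin (n + 1)))
      (fun x : M => TangentSpace (𝓡 (n + 1)) x))
    (htors : cov.torsion = 0) (hmetric : cov.IsMetricCompatible)
    (Z : ∀ x : M, TangentSpace (𝓡 (n + 1)) x) (p : M) 
    (hZ : MDifferentiableAt (𝓡 (n + 1)) (𝓡 (n + 1)).tangent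
      (fun x => (⟨x, Z x⟩ : TangentBundle (𝓡 (n + 1)) M)) p)
    (v w : TangentSpace (𝓡 (n + 1)) p) :
    leviCivitaInner Z p v w = inner ℝ (cov Z p v) w := by
  have hX := FiberBundle.mdifferentiableAt_extend (𝓡 (n + 1)) (EuclideanSpace ℝ (Fin (n + 1))) v
  have hY := FiberBundle.mdifferentiableAt_extend (𝓡 (n + 1)) (EuclideanSpace ℝ (Fin (n + 1))) w
  have hXp : FiberBundle.extend (EuclideanSpace ℝ (Fin (n + 1))) v p = v := by simp
  have hYp : FiberBundle.extend (EuclideanSpace ℝ (Fin (n + 1))) w p = w := by simp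
  unfold leviCivitaInner
  generalize FiberBundle.extend (EuclideanSpace ℝ (Fin (n + 1))) v = X at hX hXp ⊢
  generalize FiberBundle.extend (EuclideanSpace ℝ (Fin (n + 1))) w = Y at hY hYp ⊢
  have m1 := hmetric.mvfderiv_inner_eq X hZ hY
  have m2 := hmetric.mvfderiv_inner_eq Z hX hY
  have m3 := hmetric.mvfderiv_inner_eq Y hX hZ
  have t1 := cov.torsion_eq_zero_iff.1 htors hX hZ
  have t2 := cov.torsion_eq_zero_iff.1 htors hZ hY
  have t3 := cov.torsion_eq_zero_iff.1 htors hX hY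
  subst hXp hYp
  simp only at m1 m2 m3 ⊢
  rw [m1, m2, m3, ← t1, ← t2, ← t3]
  simp only [inner_sub_left]
  rw [real_inner_comm (Y p) (cov X p (Z p)), real_inner_comm (X p) (cov Z p (Y p)),
    real_inner_comm (X p) (cov Y p (Z p)), real_inner_comm (Z p) (cov Y p (X p))]
  ring

/-! ### Rigid flows -/

/-- On the open set `U` the map `f` is a submersion onto part of an open set `V` of `ℝⁿ` whose
fibres are tangent to the vector field `u`, and it is a Riemannian submersion for the metric `h`
on `V`: its differential is isometric on the orthogonal complement of the fibres. -/
structure IsRiemannianSubmersionAlong {n : ℕ} {M : Type*} [TopologicalSpace M]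
    [ChartedSpace (EuclideanSpace ℝ (Fin (n + 1))) M] [IsManifold (𝓡 (n + 1)) ∞ M]
    [RiemannianBundle (fun x : M => TangentSpace (𝓡 (n + 1)) x)]
    (u : ∀ x : M, TangentSpace (𝓡 (n + 1)) x)
    (U : Set M) (f : M → EuclideanSpace ℝ (Fin n)) (V : Set (EuclideanSpace ℝ (Fin n)))
    (h : EuclideanSpace ℝ (Fin n) →
      EuclideanSpace ℝ (Fin n) →L[ℝ] EuclideanSpace ℝ (Fin n) →L[ℝ] ℝ) : Prop where
  isOpen_source : IsOpen U
  isOpen_target : IsOpen V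
  mapsTo : Set.MapsTo f U V
  smooth_map : ContMDiffOn (𝓡 (n + 1)) (𝓡 n) ∞ f U
  smooth_metric : ContDiffOn ℝ ∞ h V
  metric_symm : ∀ y ∈ V, ∀ a b, h y a b = h y b a
  metric_pos : ∀ y ∈ V, ∀ a, a ≠ 0 → 0 < h y a a
  submersion : ∀ q ∈ U, Function.Surjective (mvfderiv (𝓡 (n + 1)) f q)
  tangent_fibre : ∀ q ∈ U, mvfderiv (𝓡 (n + 1)) f q (u q) = 0
  isometric : ∀ q ∈ U, ∀ v w : TangentSpace (𝓡 (n + 1)) q,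
    inner ℝ (u q) v = 0 → inner ℝ (u q) w = 0 →
      h (f q) (mvfderiv (𝓡 (n + 1)) f q v) (mvfderiv (𝓡 (n + 1)) f q w) = inner ℝ v w

/-- A rigid flow, given by its smooth unit velocity field `u`: the flow lines are locally the fibres
of a Riemannian submersion onto a Riemannian manifold of dimension one less. -/
structure IsRigidFlow {n : ℕ} {M : Type*} [TopologicalSpace M]
    [ChartedSpace (EuclideanSpace ℝ (Fin (n + 1))) M] [IsManifold (𝓡 (n + 1)) ∞ M]
    [RiemannianBundle (fun x : M => TangentSpace (𝓡 (n + 1)) x)]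
    (u : ∀ x : M, TangentSpace (𝓡 (n + 1)) x) : Prop where
  smooth : ContMDiff (𝓡 (n + 1)) (𝓡 (n + 1)).tangent ∞
    (fun x => (⟨x, u x⟩ : TangentBundle (𝓡 (n + 1)) M))
  unit : ∀ p, inner ℝ (u p) (u p) = 1
  rigid : ∀ p, ∃ U f V h, p ∈ U ∧ IsRiemannianSubmersionAlong u U f V h

/-- The tensor `M`: in an orthonormal frame `e₀ = u, e₁, …, eₙ` with connection form `ω` one has
`ω⁰ᵢ = Mᵢⱼ θʲ + Kᵢ ψ`, so that `Mᵢⱼ = g(∇_{eⱼ} eᵢ, u) = -g(∇_{eⱼ} u, eᵢ)`. Here `v = eᵢ`, `w = eⱼ`;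
only arguments orthogonal to the flow are meaningful. -/
def flowM {n : ℕ} {M : Type*} [TopologicalSpace M]
    [ChartedSpace (EuclideanSpace ℝ (Fin (n + 1))) M] [IsManifold (𝓡 (n + 1)) ∞ M]
    [RiemannianBundle (fun x : M => TangentSpace (𝓡 (n + 1)) x)]
    (u : ∀ x : M, TangentSpace (𝓡 (n + 1)) x) (p : M) (v w : TangentSpace (𝓡 (n + 1)) p) : ℝ :=
  -leviCivitaInner u p w v

/-- The covector `K`: in the notation of `flowM`, `Kᵢ = g(∇_u eᵢ, u) = -g(∇_u u, eᵢ)`. -/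
def flowK {n : ℕ} {M : Type*} [TopologicalSpace M]
    [ChartedSpace (EuclideanSpace ℝ (Fin (n + 1))) M] [IsManifold (𝓡 (n + 1)) ∞ M]
    [RiemannianBundle (fun x : M => TangentSpace (𝓡 (n + 1)) x)]
    (u : ∀ x : M, TangentSpace (𝓡 (n + 1)) x) (p : M) (v : TangentSpace (𝓡 (n + 1)) p) : ℝ :=
  -leviCivitaInner u p (u p) v

/-- `M` does not vanish at `p`: some component `Mᵢⱼ` is nonzero there. -/
def FlowMNeZeroAt {n : ℕ} {M : Type*} [TopologicalSpace M]
    [ChartedSpace (EuclideanSpace ℝ (Fin (n + 1))) M] [IsManifold (𝓡 (n + 1)) ∞ M]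
    [RiemannianBundle (fun x : M => TangentSpace (𝓡 (n + 1)) x)]
    (u : ∀ x : M, TangentSpace (𝓡 (n + 1)) x) (p : M) : Prop :=
  ∃ v w : TangentSpace (𝓡 (n + 1)) p,
    inner ℝ (u p) v = 0 ∧ inner ℝ (u p) w = 0 ∧ flowM u p v w ≠ 0

/-- Over `S` the components `Mᵢⱼ` of the two flows are the same function on adapted orthonormal
frames `e₀ = u, e₁, …, eₙ`: the adapted frames are the same and the values on them agree. -/
def SameFlowM {n : ℕ} {M : Type*} [TopologicalSpace M]
    [ChartedSpace (EuclideanSpace ℝ (Fin (n + 1))) M] [IsManifold (𝓡 (n + 1)) ∞ M]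
    [RiemannianBundle (fun x : M => TangentSpace (𝓡 (n + 1)) x)]
    (u u' : ∀ x : M, TangentSpace (𝓡 (n + 1)) x) (S : Set M) : Prop :=
  ∀ p ∈ S, u p = u' p ∧ ∀ v w : TangentSpace (𝓡 (n + 1)) p,
    inner ℝ (u p) v = 0 → inner ℝ (u p) w = 0 → flowM u p v w = flowM u' p v w

/-- Over `S` the components `Kᵢ` of the two flows are the same function on adapted orthonormal
frames `e₀ = u, e₁, …, eₙ`. -/
def SameFlowK {n : ℕ} {M : Type*} [TopologicalSpace M]
    [ChartedSpace (EuclideanSpace ℝ (Fin (n + 1))) M] [IsManifold (𝓡 (n + 1)) ∞ M]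
    [RiemannianBundle (fun x : M => TangentSpace (𝓡 (n + 1)) x)]
    (u u' : ∀ x : M, TangentSpace (𝓡 (n + 1)) x) (S : Set M) : Prop :=
  ∀ p ∈ S, u p = u' p ∧ ∀ v : TangentSpace (𝓡 (n + 1)) p,
    inner ℝ (u p) v = 0 → flowK u p v = flowK u' p v

/-! ### Transversal hypersurfaces -/

/-- `φ` is a regular equation of `T` in the open set `U`. -/
structure IsRegularEquation {n : ℕ} {M : Type*} [TopologicalSpace M]
    [ChartedSpace (EuclideanSpace ℝ (Fin (n + 1))) M] [IsManifold (𝓡 (n + 1)) ∞ M]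
    (T U : Set M) (φ : M → ℝ) : Prop where
  isOpen : IsOpen U
  smooth : ContMDiffOn (𝓡 (n + 1)) 𝓘(ℝ, ℝ) ∞ φ U
  regular : ∀ q ∈ U, mvfderiv (𝓡 (n + 1)) φ q ≠ 0
  eq_zero_iff : ∀ q ∈ U, q ∈ T ↔ φ q = 0

/-- `T` is a smooth (embedded, not necessarily closed) hypersurface. -/
def IsHypersurface {n : ℕ} {M : Type*} [TopologicalSpace M]
    [ChartedSpace (EuclideanSpace ℝ (Fin (n + 1))) M] [IsManifold (𝓡 (n + 1)) ∞ M]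
    (T : Set M) : Prop :=
  ∀ p ∈ T, ∃ U φ, p ∈ U ∧ IsRegularEquation (n := n) T U φ

/-- At no point of the hypersurface `T` is `u` tangent to `T`. The tangent space of `T` is the
kernel of the differential of a regular equation. -/
def IsTransversalTo {n : ℕ} {M : Type*} [TopologicalSpace M]
    [ChartedSpace (EuclideanSpace ℝ (Fin (n + 1))) M] [IsManifold (𝓡 (n + 1)) ∞ M]
    (T : Set M) (u : ∀ x : M, TangentSpace (𝓡 (n + 1)) x) : Prop :=
  ∀ p ∈ T, ∀ U φ, p ∈ U → IsRegularEquation (n := n) T U φ → mvfderiv (𝓡 (n + 1)) φ p (u p) ≠ 0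

end

/-! Where a rigid flow rotates, it solves a closed first-order total differential system. In
coordinates let ψ be the form dual to the velocity u, θ the vorticity (which is M up to sign and
order of arguments) and κ the acceleration form. Rigidity means that there is no shear, so ∇ψ = θ +
ψ ⊗ κ. Symmetry of the second derivatives of ψ expresses the horizontal derivatives of θ through (ψ,
θ, κ), and those of κ through the same data and ∂_u θ.

The missing piece is ∂_u θ. Put w = θ(X, Y) and let e_X, e_Y be the horizontal parts of the constant
vectors X, Y. Then e_X w = 2wκ(X) + f₁ and e_Y w = 2wκ(Y) + f₂, where f₁, f₂ depend on ψ and θ only.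
The bracket [e_X, e_Y] has flow component -2w, and comparing both sides of the commutator identity
gives 6 w ∂_u w = lower order terms (`controlled_θ_mul_fderiv_θ`). Where θ ≠ 0 this yields ∂_u θ,
then the horizontal derivatives of κ, and by one more commutator ∂_u κ. `Controlled` replaces
explicit formulas: it records that a quantity differs between the two flows by a smooth linear image
of a defect. The difference δ of the two triples (ψ, θ, κ) then satisfies dδ = C δ, and Grönwall's
inequality makes it vanish near each of its zeros (`IsRigidTriple.eventually_eq`).

On T the hypothesis gives ψ and θ, but not κ. If the accelerations differed at a point of T, they
would differ nearby, and the structure equation would make T orthogonal to the flow near that point.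
An orthogonal hypersurface forces θ = 0, as in Frobenius' theorem, against rotation. Hence the
1-jets agree on T (`fderiv_eq_of_hypersurface`). Finally, the set of points near which the flows
agree is open, and closed in the rotational region by continuity of the 1-jets
(`IsRigidFlow.eventually_eq_of_frequently`), so it contains each component that meets T. -/

section

set_option maxSynthPendingDepth 3

/-! ### Pairs of functions controlled by a defect -/

section Controlled

variable {E D F G H : Type*} [NormedAddCommGroup E] [NormedSpace ℝ E]
  [NormedAddCommGroup D] [NormedSpace ℝ D] [NormedAddCommGroup F] [NormedSpace ℝ F]
  [NormedAddCommGroup G] [NormedSpace ℝ G] [NormedAddCommGroup H] [NormedSpace ℝ H]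

/-- Two functions that are smooth at `p` are controlled by the function `δ` if near `p` their
difference is the value at `δ` of a smooth field of linear maps. -/
structure Controlled (p : E) (δ : E → D) (q q' : E → F) : Prop where
  left : ContDiffAt ℝ ∞ q p
  right : ContDiffAt ℝ ∞ q' p
  exists_coeff : ∃ C : E → D →L[ℝ] F, ContDiffAt ℝ ∞ C p ∧ ∀ᶠ x in 𝓝 p, q' x - q x = C x (δ x)

namespace Controlled

variable {p : E} {δ : E → D} {q q' r r' : E → F}

theorem refl (h : ContDiffAt ℝ ∞ q p) : Controlled p δ q q :=
  ⟨h, h, fun _ => 0, contDiffAt_const, by simp⟩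

theorem const (c : F) : Controlled p δ (fun _ => c) (fun _ => c) := refl contDiffAt_const

theorem congr (h : Controlled p δ q q') (hr : r =ᶠ[𝓝 p] q) (hr' : r' =ᶠ[𝓝 p] q') :
    Controlled p δ r r' := by
  obtain ⟨C, hC, h1⟩ := h.exists_coeff
  refine ⟨h.left.congr_of_eventuallyEq hr, h.right.congr_of_eventuallyEq hr', C, hC, ?_⟩
  filter_upwards [h1, hr, hr'] with x h1 h2 h3
  rw [h2, h3, h1]

theorem add (h : Controlled p δ q q') (k : Controlled p δ r r') :
    Controlled p δ (fun x => q x + r x) (fun x => q' x + r' x) := by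
  obtain ⟨C, hC, h1⟩ := h.exists_coeff
  obtain ⟨C2, hC2, h2⟩ := k.exists_coeff
  refine ⟨h.left.add k.left, h.right.add k.right, fun x => C x + C2 x, hC.add hC2, ?_⟩
  filter_upwards [h1, h2] with x h1 h2
  simp only [_root_.add_apply, ← h1, ← h2]
  abel

theorem clm_comp_const (L : F →L[ℝ] G) (h : Controlled p δ q q') :
    Controlled p δ (fun x => L (q x)) (fun x => L (q' x)) := by
  obtain ⟨C, hC, h1⟩ := h.exists_coeff
  refine ⟨L.contDiff.contDiffAt.comp p h.left, L.contDiff.contDiffAt.comp p h.right,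
    fun x => L.comp (C x), contDiffAt_const.clm_comp hC, ?_⟩
  filter_upwards [h1] with x h1
  simp [← h1]

theorem neg (h : Controlled p δ q q') : Controlled p δ (fun x => -q x) (fun x => -q' x) := by
  simpa using h.clm_comp_const (-ContinuousLinearMap.id ℝ F)

theorem sub (h : Controlled p δ q q') (k : Controlled p δ r r') :
    Controlled p δ (fun x => q x - r x) (fun x => q' x - r' x) := by
  simpa [sub_eq_add_neg] using h.add k.neg

theorem clm_apply {B B' : E → F →L[ℝ] G} (h : Controlled p δ B B') (k : Controlled p δ q q') :
    Controlled p δ (fun x => B x (q x)) (fun x => B' x (q' x)) := by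
  obtain ⟨C, hC, h1⟩ := h.exists_coeff
  obtain ⟨C2, hC2, h2⟩ := k.exists_coeff
  -- The coefficient comes from the splitting `B' q' - B q = (B' - B) q' + B (q' - q)`.
  refine ⟨h.left.clm_apply k.left, h.right.clm_apply k.right,
    fun x => (C x).flip (q' x) + (B x).comp (C2 x), ?_, ?_⟩
  · refine ContDiffAt.add (ContDiffAt.clm_apply ?_ k.right) (h.left.clm_comp hC2)
    exact (ContinuousLinearMap.flipₗᵢ ℝ D F G).contDiff.contDiffAt.comp p hC
  · filter_upwards [h1, h2] with x h1 h2
    simp only [_root_.add_apply, ContinuousLinearMap.flip_apply, ← h1,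
      ContinuousLinearMap.comp_apply, ← h2, map_sub, _root_.sub_apply]
    abel

theorem smul {a a' : E → ℝ} (h : Controlled p δ a a') (k : Controlled p δ q q') :
    Controlled p δ (fun x => a x • q x) (fun x => a' x • q' x) :=
  (h.clm_comp_const (ContinuousLinearMap.lsmul ℝ ℝ (E := F))).clm_apply k

theorem mul {a a' b b' : E → ℝ} (h : Controlled p δ a a') (k : Controlled p δ b b') :
    Controlled p δ (fun x => a x * b x) (fun x => a' x * b' x) := h.smul k

theorem smulRight {a a' : E → F →L[ℝ] ℝ} {v v' : E → G} (h : Controlled p δ a a')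
    (k : Controlled p δ v v') :
    Controlled p δ (fun x => (a x).smulRight (v x)) (fun x => (a' x).smulRight (v' x)) :=
  (h.clm_comp_const (ContinuousLinearMap.smulRightL ℝ F G)).clm_apply k

theorem inv {a a' : E → ℝ} (h : Controlled p δ a a') (h0 : a p ≠ 0) (h0' : a' p ≠ 0) :
    Controlled p δ (fun x => (a x)⁻¹) (fun x => (a' x)⁻¹) := by
  obtain ⟨C, hC, h1⟩ := h.exists_coeff
  refine ⟨h.left.inv h0, h.right.inv h0', fun x => (-((a x)⁻¹ * (a' x)⁻¹)) • C x,
    (((h.left.inv h0).mul (h.right.inv h0')).neg).smul hC, ?_⟩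
  filter_upwards [h1, h.left.continuousAt.eventually_ne h0, h.right.continuousAt.eventually_ne h0']
    with x h1 h2 h3
  simp only [_root_.smul_apply, ← h1, smul_eq_mul]
  field_simp
  ring

/-- Division by a factor that vanishes for neither function. Nonvanishing vorticity enters the local
argument through this cancellation. -/
theorem of_mul_left {a a' : E → ℝ} (h : Controlled p δ a a') (h0 : a p ≠ 0) (h0' : a' p ≠ 0)
    (k : Controlled p δ (fun x => a x • q x) (fun x => a' x • q' x)) : Controlled p δ q q' := by
  refine ((h.inv h0 h0').smul k).congr ?_ ?_
  · filter_upwards [h.left.continuousAt.eventually_ne h0] with x hx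
    rw [inv_smul_smul₀ hx]
  · filter_upwards [h.right.continuousAt.eventually_ne h0'] with x hx
    rw [inv_smul_smul₀ hx]

/-- In finite dimension a field of linear maps is a finite sum of fixed coordinate forms times its
values on a basis. -/
theorem clm_of_apply [FiniteDimensional ℝ F] {B B' : E → F →L[ℝ] G}
    (h : ∀ v, Controlled p δ (fun x => B x v) (fun x => B' x v)) : Controlled p δ B B' := by
  let b := Module.finBasis ℝ F
  let c : Fin (Module.finrank ℝ F) → F →L[ℝ] ℝ := fun i => LinearMap.toContinuousLinearMap (b.coord i)
  have key : ∀ A : F →L[ℝ] G, A = ∑ i, (c i).smulRight (A (b i)) := by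
    intro A
    ext v
    have := congrArg A (b.sum_repr v)
    rw [map_sum] at this
    simp [c, ← this]
  have hs : ∀ s : Finset (Fin (Module.finrank ℝ F)), Controlled p δ
      (fun x => ∑ i ∈ s, (c i).smulRight (B x (b i)))
      (fun x => ∑ i ∈ s, (c i).smulRight (B' x (b i))) := by
    intro s
    induction s using Finset.induction_on with
    | empty => simpa using const (0 : F →L[ℝ] G)
    | insert i s hi ih =>
      simp only [Finset.sum_insert hi]
      exact ((const (c i)).smulRight (h (b i))).add ih
  refine (hs Finset.univ).congr ?_ ?_
  · exact Filter.Eventually.of_forall fun x => key _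
  · exact Filter.Eventually.of_forall fun x => key _

/-- The coefficient is the identity. This is the seed from which the control of all other quantities
is built. -/
theorem self {j j' : E → G} (h : ContDiffAt ℝ ∞ j p) (h' : ContDiffAt ℝ ∞ j' p) :
    Controlled p (fun x => j' x - j x) j j' :=
  ⟨h, h', fun _ => ContinuousLinearMap.id ℝ G, contDiffAt_const, by simp⟩

theorem fderiv_smooth {f : E → F} (h : ContDiffAt ℝ ∞ f p) : ContDiffAt ℝ ∞ (fderiv ℝ f) p :=
  h.fderiv_right (by simp)

theorem eventually_differentiableAt {f : E → F} (h : ContDiffAt ℝ ∞ f p) :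
    ∀ᶠ x in 𝓝 p, DifferentiableAt ℝ f x := by
  have h1 : ContDiffAt ℝ 1 f p := h.of_le (by simp)
  filter_upwards [h1.eventually (by simp)] with x hx
  exact hx.differentiableAt (by simp)

/-- If a quantity is controlled by the defect of `j`, then its derivative along `a` is controlled
whenever that of `j` is. -/
theorem fderiv_apply {j j' : E → G} {a a' : E → E}
    (hq : Controlled p (fun x => j' x - j x) q q') (hj : Controlled p δ j j')
    (ha : Controlled p δ a a')
    (hd : Controlled p δ (fun x => fderiv ℝ j x (a x)) (fun x => fderiv ℝ j' x (a' x))) :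
    Controlled p δ (fun x => fderiv ℝ q x (a x)) (fun x => fderiv ℝ q' x (a' x)) := by
  obtain ⟨C, hC, h1⟩ := hq.exists_coeff
  have hC1 := fderiv_smooth hC
  -- Differentiating `q' = q + C (j' - j)` along `a'` gives three terms: the derivative of `q`, the
  -- derivative of `C` applied to the defect of `j`, and `C` applied to the derivative of that
  -- defect. Each is controlled by `δ`.
  have h0 : Controlled p δ (fun x => fderiv ℝ q x (a x)) (fun x => fderiv ℝ q x (a' x)) :=
    (refl (fderiv_smooth hq.left)).clm_apply ha
  have hz : Controlled p δ (fun _ => (0 : G)) (fun x => j' x - j x) := by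
    simpa using hj.sub (refl hj.left)
  have e1 : Controlled p δ (fun x => fderiv ℝ C x (a' x) 0)
      (fun x => fderiv ℝ C x (a' x) (j' x - j x)) :=
    ((refl hC1).clm_apply (refl ha.right)).clm_apply hz
  have e2 : Controlled p δ
      (fun x => C x (fderiv ℝ j x (a x) - fderiv ℝ j x (a x)))
      (fun x => C x (fderiv ℝ j' x (a' x) - fderiv ℝ j x (a' x))) :=
    (refl hC).clm_apply (hd.sub ((refl (fderiv_smooth hj.left)).clm_apply ha))
  refine ((h0.add e1).add e2).congr (Filter.Eventually.of_forall fun x => by simp) ?_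
  filter_upwards [h1.eventually_nhds, eventually_differentiableAt hC,
    eventually_differentiableAt hj.left, eventually_differentiableAt hj.right,
    eventually_differentiableAt hq.left] with x hx dC dj dj' dq
  have hx' : q' =ᶠ[𝓝 x] fun y => q y + C y (j' y - j y) := by
    filter_upwards [hx] with y hy
    rw [← hy]; abel
  have hd : HasFDerivAt (fun y => q y + C y (j' y - j y)) _ x :=
    dq.hasFDerivAt.add (dC.hasFDerivAt.clm_apply (dj'.hasFDerivAt.sub dj.hasFDerivAt))
  rw [hx'.fderiv_eq, hd.fderiv]
  simp
  abel

end Controlled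

/-- A function whose derivative is a continuous linear function of its value vanishes near every
zero. -/
theorem eventually_eq_zero_of_fderiv_eq {δ : E → D} {C : E → D →L[ℝ] (E →L[ℝ] D)} {p : E}
    (hδ : ∀ᶠ x in 𝓝 p, DifferentiableAt ℝ δ x) (hC : ContinuousAt C p)
    (h : ∀ᶠ x in 𝓝 p, fderiv ℝ δ x = C x (δ x)) (h0 : δ p = 0) : ∀ᶠ x in 𝓝 p, δ x = 0 := by
  obtain ⟨K, hK⟩ : ∃ K, ∀ᶠ x in 𝓝 p, ‖C x‖ ≤ K :=
    ⟨‖C p‖ + 1, (hC.norm.eventually_le_const (by linarith))⟩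
  obtain ⟨ε, hε, hball⟩ := Metric.eventually_nhds_iff_ball.1 (hδ.and (h.and hK))
  refine Metric.eventually_nhds_iff_ball.2 ⟨ε, hε, fun x hx => ?_⟩
  let γ : ℝ → E := fun t => p + t • (x - p)
  have hγ : ∀ t ∈ Set.Icc (0 : ℝ) 1, γ t ∈ Metric.ball p ε := by
    intro t ht
    rw [mem_ball_iff_norm] at hx ⊢
    simp only [γ, add_sub_cancel_left, norm_smul, Real.norm_eq_abs, abs_of_nonneg ht.1]
    nlinarith [ht.2, norm_nonneg (x - p)]
  have hγ' : ∀ t, HasDerivAt γ (x - p) t := fun t => by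
    simpa [γ] using ((hasDerivAt_id t).smul_const (x - p)).const_add p
  have hd : ∀ t ∈ Set.Icc (0 : ℝ) 1, HasDerivAt (δ ∘ γ) (fderiv ℝ δ (γ t) (x - p)) t :=
    fun t ht => (hball _ (hγ t ht)).1.hasFDerivAt.comp_hasDerivAt t (hγ' t)
  -- Grönwall on the segment from `p` to `x`: zero initial value and no inhomogeneous term, so the
  -- bound is zero.
  have := norm_le_gronwallBound_of_norm_deriv_right_le (f := δ ∘ γ)
    (f' := fun t => fderiv ℝ δ (γ t) (x - p)) (δ := 0) (K := K * ‖x - p‖) (ε := 0) (a := 0) (b := 1)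
    (fun t ht => (hd t ht).continuousAt.continuousWithinAt)
    (fun t ht => (hd t ⟨ht.1, ht.2.le⟩).hasDerivWithinAt) (by simp [γ, h0]) (fun t ht => by
      have h1 := hball _ (hγ t ⟨ht.1, ht.2.le⟩)
      rw [h1.2.1, add_zero]
      calc _ ≤ ‖C (γ t) (δ (γ t))‖ * ‖x - p‖ := ContinuousLinearMap.le_opNorm _ _
        _ ≤ (K * ‖δ (γ t)‖) * ‖x - p‖ := by
          gcongr
          exact (ContinuousLinearMap.le_opNorm _ _).trans (by gcongr; exact h1.2.2)
        _ = _ := by simp; ring) 1 (by simp)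
  simpa [γ, gronwallBound_ε0] using this

end Controlled

/-! ### The structure equations of a rigid flow in coordinates -/

section RigidGerm

variable {E : Type*} [NormedAddCommGroup E] [NormedSpace ℝ E]

/-- The coordinate expression, near the point `p` of a vector space, of a rigid flow: the velocity
`u`, the dual form `ψ`, the Christoffel term `Γ`, the vorticity `θ` and the acceleration `κ`. -/
structure RigidGerm (p : E) (u : E → E) (ψ : E → E →L[ℝ] ℝ) (Γ θ : E → E →L[ℝ] E →L[ℝ] ℝ)
    (κ : E → E →L[ℝ] ℝ) : Prop where
  smooth_u : ContDiffAt ℝ ∞ u p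
  smooth_ψ : ContDiffAt ℝ ∞ ψ p
  smooth_Γ : ContDiffAt ℝ ∞ Γ p
  smooth_θ : ContDiffAt ℝ ∞ θ p
  smooth_κ : ContDiffAt ℝ ∞ κ p
  Γ_symm : ∀ᶠ x in 𝓝 p, ∀ a b, Γ x a b = Γ x b a
  ψ_u : ∀ᶠ x in 𝓝 p, ψ x (u x) = 1
  κ_u : ∀ᶠ x in 𝓝 p, κ x (u x) = 0
  θ_u : ∀ᶠ x in 𝓝 p, ∀ b, θ x (u x) b = 0
  θ_antisymm : ∀ᶠ x in 𝓝 p, ∀ a b, θ x a b = -θ x b a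
  fderiv_ψ : ∀ᶠ x in 𝓝 p, ∀ a b, fderiv ℝ ψ x a b = Γ x a b + θ x a b + ψ x a * κ x b

namespace RigidGerm

open Controlled

variable {p : E} {u : E → E} {ψ : E → E →L[ℝ] ℝ} {Γ θ : E → E →L[ℝ] E →L[ℝ] ℝ}
    {κ : E → E →L[ℝ] ℝ}

/-- Differentiating the structure equation once more expresses the second derivative of `ψ`, which
is symmetric. This integrability condition is the source of the horizontal derivatives of both `θ`
and `κ`. -/
theorem symm_second (h : RigidGerm p u ψ Γ θ κ) : ∀ᶠ x in 𝓝 p, ∀ c a b,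
    fderiv ℝ Γ x c a b + fderiv ℝ θ x c a b + fderiv ℝ ψ x c a * κ x b + ψ x a * fderiv ℝ κ x c b
      = fderiv ℝ Γ x a c b + fderiv ℝ θ x a c b + fderiv ℝ ψ x a c * κ x b
        + ψ x c * fderiv ℝ κ x a b := by
  have h2 : ContDiffAt ℝ 2 ψ p := h.smooth_ψ.of_le (by norm_cast)
  filter_upwards [h.fderiv_ψ.eventually_nhds, eventually_differentiableAt h.smooth_ψ,
    eventually_differentiableAt h.smooth_Γ, eventually_differentiableAt h.smooth_θ,
    eventually_differentiableAt h.smooth_κ, h2.eventually (by simp)] with x hx dψ dΓ dθ dκ h2 c a b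
  have hs : IsSymmSndFDerivAt ℝ ψ x := h2.isSymmSndFDerivAt (by simp)
  have e : fderiv ℝ ψ =ᶠ[𝓝 x] fun y => Γ y + θ y + (ψ y).smulRight (κ y) := by
    filter_upwards [hx] with y hy
    ext a b
    simp [hy]
  have d : HasFDerivAt (fun y => Γ y + θ y + (ψ y).smulRight (κ y)) _ x :=
    (dΓ.hasFDerivAt.add dθ.hasFDerivAt).add
      (((ContinuousLinearMap.smulRightL ℝ E (E →L[ℝ] ℝ)).hasFDerivAt.comp x
        dψ.hasFDerivAt).clm_apply dκ.hasFDerivAt)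
  have h3 := congrArg (fun L => L b) (hs c a)
  rw [e.fderiv_eq, d.fderiv] at h3
  simp at h3
  linear_combination h3

theorem fderiv_θ_u (h : RigidGerm p u ψ Γ θ κ) : ∀ᶠ x in 𝓝 p, ∀ c b,
    fderiv ℝ θ x c (u x) b = -θ x (fderiv ℝ u x c) b := by
  filter_upwards [h.θ_u.eventually_nhds, eventually_differentiableAt h.smooth_θ,
    eventually_differentiableAt h.smooth_u] with x hx dθ du c b
  have d := dθ.hasFDerivAt.clm_apply du.hasFDerivAt
  have e : (fun y => θ y (u y)) =ᶠ[𝓝 x] fun _ => 0 := by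
    filter_upwards [hx] with y hy
    ext b
    simp [hy]
  have := congrArg (fun L => L c b) (d.fderiv.symm.trans e.fderiv_eq)
  simp at this
  linarith

theorem fderiv_θ_antisymm (h : RigidGerm p u ψ Γ θ κ) : ∀ᶠ x in 𝓝 p, ∀ c a b,
    fderiv ℝ θ x c a b = -fderiv ℝ θ x c b a := by
  filter_upwards [h.θ_antisymm.eventually_nhds, eventually_differentiableAt h.smooth_θ]
    with x hx dθ c a b
  have e : θ =ᶠ[𝓝 x] fun y => -(θ y).flip := by
    filter_upwards [hx] with y hy
    ext a b
    simp [hy a b]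
  have d : HasFDerivAt (fun y => -(θ y).flip) _ x :=
    ((ContinuousLinearMap.flipₗᵢ ℝ E E ℝ).toContinuousLinearEquiv.toContinuousLinearMap.hasFDerivAt.comp
      x dθ.hasFDerivAt).neg
  have := congrArg (fun L => L c a b) (e.fderiv_eq.trans d.fderiv)
  simpa using this

/-- The horizontal derivative of the vorticity. -/
theorem fderiv_θ_horizontal (h : RigidGerm p u ψ Γ θ κ) : ∀ᶠ x in 𝓝 p, ∀ c a b,
    ψ x c = 0 → ψ x a = 0 → ψ x b = 0 →
    2 * fderiv ℝ θ x c a b =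
      (-2 * θ x c a * κ x b - (fderiv ℝ Γ x c a b - fderiv ℝ Γ x a c b))
      + (-2 * θ x b c * κ x a - (fderiv ℝ Γ x b c a - fderiv ℝ Γ x c b a))
      - (-2 * θ x a b * κ x c - (fderiv ℝ Γ x a b c - fderiv ℝ Γ x b a c)) := by
  filter_upwards [h.symm_second, h.fderiv_ψ, h.fderiv_θ_antisymm, h.Γ_symm, h.θ_antisymm]
    with x h1 h2 h3 h4 h5 c a b hc ha hb
  -- For horizontal `c` and `a` the derivatives of `κ` drop out, so swapping the first two slots of
  -- `∂θ` costs only known terms. Antisymmetry in the last two slots then isolates one component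
  -- from three permutations, as in Koszul's formula.
  have m : ∀ c a b, ψ x c = 0 → ψ x a = 0 → fderiv ℝ θ x c a b - fderiv ℝ θ x a c b =
      -2 * θ x c a * κ x b - (fderiv ℝ Γ x c a b - fderiv ℝ Γ x a c b) := by
    intro c a b hc ha
    have := h1 c a b
    rw [h2, h2, hc, ha, h4 a c, h5 a c] at this
    linear_combination this
  linear_combination m c a b hc ha + m b c a hb hc - m a b c ha hb + h3 a c b
    - h3 b c a + h3 c a b

/-- The horizontal derivative of the acceleration. -/
theorem fderiv_κ_horizontal (h : RigidGerm p u ψ Γ θ κ) : ∀ᶠ x in 𝓝 p, ∀ a b, ψ x a = 0 →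
    fderiv ℝ κ x a b = fderiv ℝ θ x (u x) a b + (fderiv ℝ Γ x (u x) a b - fderiv ℝ Γ x a (u x) b
      + κ x a * κ x b + θ x (fderiv ℝ u x a) b) := by
  filter_upwards [h.symm_second, h.fderiv_ψ, h.Γ_symm, h.θ_antisymm, h.fderiv_θ_u, h.ψ_u, h.θ_u,
    h.κ_u] with x h1 h2 h3 h4 h5 h6 h7 h8 a b ha
  -- With one slot along the flow, `ψ u = 1` leaves the derivative of `κ` along `a` with coefficient
  -- one, while `ψ a = 0` removes the derivative of `κ` along the flow.
  have := h1 (u x) a b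
  rw [h2, h2, ha, h6, h5, h3 a, h4 a, h7, h8] at this
  linear_combination -this

end RigidGerm

end RigidGerm

/-! ### Comparison of two rigid flows in coordinates -/

section Comparison

variable {E F : Type*} [NormedAddCommGroup E] [NormedSpace ℝ E]
  [NormedAddCommGroup F] [NormedSpace ℝ F]

/-- The derivatives of a function along two vector fields commute up to the Lie bracket. -/
theorem fderiv_fderiv_sub_eq {q : E → F} {a b : E → E} {p : E} (hq : ContDiffAt ℝ ∞ q p)
    (ha : ContDiffAt ℝ ∞ a p) (hb : ContDiffAt ℝ ∞ b p) : ∀ᶠ x in 𝓝 p,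
    fderiv ℝ (fun y => fderiv ℝ q y (b y)) x (a x) - fderiv ℝ (fun y => fderiv ℝ q y (a y)) x (b x)
      = fderiv ℝ q x (fderiv ℝ b x (a x) - fderiv ℝ a x (b x)) := by
  have h2 : ContDiffAt ℝ 2 q p := hq.of_le (by norm_cast)
  filter_upwards [Controlled.eventually_differentiableAt (Controlled.fderiv_smooth hq),
    Controlled.eventually_differentiableAt ha, Controlled.eventually_differentiableAt hb,
    h2.eventually (by simp)] with x dq da db h2
  have hs : IsSymmSndFDerivAt ℝ q x := h2.isSymmSndFDerivAt (by simp)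
  rw [(dq.hasFDerivAt.clm_apply db.hasFDerivAt).fderiv,
    (dq.hasFDerivAt.clm_apply da.hasFDerivAt).fderiv]
  simp [hs (a x) (b x)]

/-- The part of the constant vector `X` in the kernel of `ψ`, along the velocity `s ψ`. -/
noncomputable def horizontalPart (s : E → (E →L[ℝ] ℝ) →L[ℝ] E) (ψ : E → E →L[ℝ] ℝ) (X : E) (x : E) : E :=
  X - ψ x X • s x (ψ x)

variable {p : E} {s : E → (E →L[ℝ] ℝ) →L[ℝ] E}
  {γ : E → (E →L[ℝ] ℝ) →L[ℝ] E →L[ℝ] E →L[ℝ] ℝ}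
  {ψ ψ' κ κ' : E → E →L[ℝ] ℝ} {θ θ' : E → E →L[ℝ] E →L[ℝ] ℝ}

/-- A rigid flow whose velocity and Christoffel term are given by fixed fields of linear maps. -/
abbrev IsRigidTriple (p : E) (s : E → (E →L[ℝ] ℝ) →L[ℝ] E)
    (γ : E → (E →L[ℝ] ℝ) →L[ℝ] E →L[ℝ] E →L[ℝ] ℝ) (ψ : E → E →L[ℝ] ℝ)
    (θ : E → E →L[ℝ] E →L[ℝ] ℝ) (κ : E → E →L[ℝ] ℝ) : Prop :=
  RigidGerm p (fun x => s x (ψ x)) ψ (fun x => γ x (ψ x)) θ κ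

namespace IsRigidTriple

open Controlled


theorem ψ_horizontalPart (h : IsRigidTriple p s γ ψ θ κ) :
    ∀ᶠ x in 𝓝 p, ∀ X, ψ x (horizontalPart s ψ X x) = 0 := by
  filter_upwards [h.ψ_u] with x hx
  simp [horizontalPart, hx]

theorem κ_horizontalPart (h : IsRigidTriple p s γ ψ θ κ) :
    ∀ᶠ x in 𝓝 p, ∀ X, κ x (horizontalPart s ψ X x) = κ x X := by
  filter_upwards [h.κ_u] with x hx
  simp [horizontalPart, hx]

theorem θ_horizontalPart (h : IsRigidTriple p s γ ψ θ κ) :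
    ∀ᶠ x in 𝓝 p, ∀ X Y, θ x (horizontalPart s ψ X x) Y = θ x X Y := by
  filter_upwards [h.θ_u] with x hx
  simp [horizontalPart, hx]

variable {D : Type*} [NormedAddCommGroup D] [NormedSpace ℝ D] {δ : E → D}

theorem controlled_u (hs : ContDiffAt ℝ ∞ s p) (cψ : Controlled p δ ψ ψ') :
    Controlled p δ (fun x => s x (ψ x)) (fun x => s x (ψ' x)) := (Controlled.refl hs).clm_apply cψ

theorem controlled_Γ (hγ : ContDiffAt ℝ ∞ γ p) (cψ : Controlled p δ ψ ψ') :
    Controlled p δ (fun x => γ x (ψ x)) (fun x => γ x (ψ' x)) := (Controlled.refl hγ).clm_apply cψ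

theorem controlled_horizontalPart (hs : ContDiffAt ℝ ∞ s p) (cψ : Controlled p δ ψ ψ') (X : E) :
    Controlled p δ (horizontalPart s ψ X) (horizontalPart s ψ' X) :=
  (Controlled.const X).sub ((cψ.clm_apply (Controlled.const X)).smul (controlled_u hs cψ))

/-- In a horizontal direction the term `ψ ⊗ κ` of the structure equation vanishes, so no control of
`κ` is needed. The commutator argument depends on this. -/
theorem controlled_fderiv_ψ_horizontal [FiniteDimensional ℝ E] (h : IsRigidTriple p s γ ψ θ κ)
    (h' : IsRigidTriple p s γ ψ' θ' κ') (hs : ContDiffAt ℝ ∞ s p) (hγ : ContDiffAt ℝ ∞ γ p)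
    (cψ : Controlled p δ ψ ψ') (cθ : Controlled p δ θ θ') (X : E) :
    Controlled p δ (fun x => fderiv ℝ ψ x (horizontalPart s ψ X x))
      (fun x => fderiv ℝ ψ' x (horizontalPart s ψ' X x)) := by
  have c1 := controlled_horizontalPart hs cψ X
  refine (((controlled_Γ hγ cψ).clm_apply c1).add (cθ.clm_apply c1)).congr ?_ ?_
  · filter_upwards [h.fderiv_ψ, h.ψ_horizontalPart] with x h1 h2
    ext b
    simp [h1, h2]
  · filter_upwards [h'.fderiv_ψ, h'.ψ_horizontalPart] with x h1 h2
    ext b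
    simp [h1, h2]

theorem controlled_fderiv_ψ (h : IsRigidTriple p s γ ψ θ κ)
    (h' : IsRigidTriple p s γ ψ' θ' κ') (hγ : ContDiffAt ℝ ∞ γ p)
    (cψ : Controlled p δ ψ ψ') (cθ : Controlled p δ θ θ') (cκ : Controlled p δ κ κ') :
    Controlled p δ (fderiv ℝ ψ) (fderiv ℝ ψ') := by
  refine (((controlled_Γ hγ cψ).add cθ).add (cψ.smulRight cκ)).congr ?_ ?_
  · filter_upwards [h.fderiv_ψ] with x h1
    ext a b
    simp [h1]
  · filter_upwards [h'.fderiv_ψ] with x h1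
    ext a b
    simp [h1]

/-- The derivative along `a` of a field of linear maps applied to `ψ`. -/
theorem controlled_fderiv_clm_apply {m : E → (E →L[ℝ] ℝ) →L[ℝ] F} {a a' : E → E}
    (hm : ContDiffAt ℝ ∞ m p) (cψ : Controlled p δ ψ ψ') (ca : Controlled p δ a a')
    (cd : Controlled p δ (fun x => fderiv ℝ ψ x (a x)) (fun x => fderiv ℝ ψ' x (a' x))) :
    Controlled p δ (fun x => fderiv ℝ (fun y => m y (ψ y)) x (a x))
      (fun x => fderiv ℝ (fun y => m y (ψ' y)) x (a' x)) := by
  refine ((((Controlled.refl (fderiv_smooth hm)).clm_apply ca).clm_apply cψ).add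
    ((Controlled.refl hm).clm_apply cd)).congr ?_ ?_
  · filter_upwards [eventually_differentiableAt hm, eventually_differentiableAt cψ.left]
      with x dm dψ
    rw [(dm.hasFDerivAt.clm_apply dψ.hasFDerivAt).fderiv]
    simp [add_comm]
  · filter_upwards [eventually_differentiableAt hm, eventually_differentiableAt cψ.right]
      with x dm dψ
    rw [(dm.hasFDerivAt.clm_apply dψ.hasFDerivAt).fderiv]
    simp [add_comm]

/-- The derivative of the vorticity along a horizontal vector, on horizontal arguments. -/
theorem controlled_fderiv_θ_horizontal₃ [FiniteDimensional ℝ E] (h : IsRigidTriple p s γ ψ θ κ)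
    (h' : IsRigidTriple p s γ ψ' θ' κ') (hs : ContDiffAt ℝ ∞ s p) (hγ : ContDiffAt ℝ ∞ γ p)
    (cψ : Controlled p δ ψ ψ') (cθ : Controlled p δ θ θ') (cκ : Controlled p δ κ κ') (X Y Z : E) :
    Controlled p δ
      (fun x => fderiv ℝ θ x (horizontalPart s ψ Z x) (horizontalPart s ψ X x)
        (horizontalPart s ψ Y x))
      (fun x => fderiv ℝ θ' x (horizontalPart s ψ' Z x) (horizontalPart s ψ' X x)
        (horizontalPart s ψ' Y x)) := by
  have cX := controlled_horizontalPart hs cψ (δ := δ)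
  have cD : ∀ Z, _ := fun Z => controlled_fderiv_clm_apply hγ cψ (cX Z)
    (controlled_fderiv_ψ_horizontal h h' hs hγ cψ cθ Z)
  have cm : ∀ X Y Z, _ := fun X Y Z =>
    ((((cθ.clm_apply (cX Z)).clm_apply (cX X)).mul (cκ.clm_apply (cX Y))).clm_comp_const
      ((-2 : ℝ) • ContinuousLinearMap.id ℝ ℝ)).sub
      ((((cD Z).clm_apply (cX X)).clm_apply (cX Y)).sub
        (((cD X).clm_apply (cX Z)).clm_apply (cX Y)))
  refine ((((cm X Y Z).add (cm Z X Y)).sub (cm Y Z X)).clm_comp_const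
    ((1 / 2 : ℝ) • ContinuousLinearMap.id ℝ ℝ)).congr ?_ ?_
  · filter_upwards [h.fderiv_θ_horizontal, h.ψ_horizontalPart] with x h1 h2
    have := h1 _ _ _ (h2 Z) (h2 X) (h2 Y)
    simp only [_root_.smul_apply, ContinuousLinearMap.id_apply, smul_eq_mul]
    linear_combination (1 / 2) * this
  · filter_upwards [h'.fderiv_θ_horizontal, h'.ψ_horizontalPart] with x h1 h2
    have := h1 _ _ _ (h2 Z) (h2 X) (h2 Y)
    simp only [_root_.smul_apply, ContinuousLinearMap.id_apply, smul_eq_mul]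
    linear_combination (1 / 2) * this

/-- Arbitrary arguments differ from horizontal ones by multiples of the velocity, and on the
velocity the derivative of `θ` is algebraic because `θ u = 0`. -/
theorem controlled_fderiv_θ_horizontal [FiniteDimensional ℝ E] (h : IsRigidTriple p s γ ψ θ κ)
    (h' : IsRigidTriple p s γ ψ' θ' κ') (hs : ContDiffAt ℝ ∞ s p) (hγ : ContDiffAt ℝ ∞ γ p)
    (cψ : Controlled p δ ψ ψ') (cθ : Controlled p δ θ θ') (cκ : Controlled p δ κ κ') (Z : E) :
    Controlled p δ (fun x => fderiv ℝ θ x (horizontalPart s ψ Z x))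
      (fun x => fderiv ℝ θ' x (horizontalPart s ψ' Z x)) := by
  refine clm_of_apply fun X => clm_of_apply fun Y => ?_
  have cX := controlled_horizontalPart hs cψ (δ := δ)
  have cDu := controlled_fderiv_clm_apply hs cψ (cX Z)
    (controlled_fderiv_ψ_horizontal h h' hs hγ cψ cθ Z)
  have cθu := cθ.clm_apply cDu
  refine (((controlled_fderiv_θ_horizontal₃ h h' hs hγ cψ cθ cκ X Y Z).sub
    ((cψ.clm_apply (Controlled.const X)).mul (cθu.clm_apply (Controlled.const Y)))).add
    ((cψ.clm_apply (Controlled.const Y)).mul (cθu.clm_apply (cX X)))).congr ?_ ?_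
  · filter_upwards [h.fderiv_θ_u, h.fderiv_θ_antisymm] with x h1 h2
    have e1 := h1 (horizontalPart s ψ Z x) Y
    have e2 := h1 (horizontalPart s ψ Z x) (horizontalPart s ψ X x)
    have e3 := h2 (horizontalPart s ψ Z x) (horizontalPart s ψ X x) (s x (ψ x))
    conv at e3 => rhs; rw [e2]
    generalize fderiv ℝ θ x (horizontalPart s ψ Z x) = L at *
    simp only [horizontalPart, map_sub, map_smul, _root_.sub_apply, _root_.smul_apply,
      smul_eq_mul] at *
    linear_combination ψ x X * e1 + ψ x Y * e3
  · filter_upwards [h'.fderiv_θ_u, h'.fderiv_θ_antisymm] with x h1 h2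
    have e1 := h1 (horizontalPart s ψ' Z x) Y
    have e2 := h1 (horizontalPart s ψ' Z x) (horizontalPart s ψ' X x)
    have e3 := h2 (horizontalPart s ψ' Z x) (horizontalPart s ψ' X x) (s x (ψ' x))
    conv at e3 => rhs; rw [e2]
    generalize fderiv ℝ θ' x (horizontalPart s ψ' Z x) = L at *
    simp only [horizontalPart, map_sub, map_smul, _root_.sub_apply, _root_.smul_apply,
      smul_eq_mul] at *
    linear_combination ψ' x X * e1 + ψ' x Y * e3

end IsRigidTriple
end Comparison

/-! ### Derivatives of vorticity and acceleration modulo lower order terms -/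

section Closure

variable {E F : Type*} [NormedAddCommGroup E] [NormedSpace ℝ E]
  [NormedAddCommGroup F] [NormedSpace ℝ F]
  {p : E} {s : E → (E →L[ℝ] ℝ) →L[ℝ] E}
  {γ : E → (E →L[ℝ] ℝ) →L[ℝ] E →L[ℝ] E →L[ℝ] ℝ}
  {ψ ψ' κ κ' : E → E →L[ℝ] ℝ} {θ θ' : E → E →L[ℝ] E →L[ℝ] ℝ}
  {D : Type*} [NormedAddCommGroup D] [NormedSpace ℝ D] {δ : E → D}

namespace IsRigidTriple

open Controlled

/-- The derivative of the component `θ X Y` along the horizontal part of `X`. -/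
theorem fderiv_θ_sectional (h : IsRigidTriple p s γ ψ θ κ) : ∀ᶠ x in 𝓝 p, ∀ X Y,
    fderiv ℝ θ x (horizontalPart s ψ X x) X Y = 2 * (θ x X Y * κ x X)
      + (fderiv ℝ (fun y => γ y (ψ y)) x (horizontalPart s ψ X x) (horizontalPart s ψ Y x)
          (horizontalPart s ψ X x)
        - fderiv ℝ (fun y => γ y (ψ y)) x (horizontalPart s ψ Y x) (horizontalPart s ψ X x)
          (horizontalPart s ψ X x)
        - ψ x X * θ x (fderiv ℝ (fun y => s y (ψ y)) x (horizontalPart s ψ X x)) Y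
        + ψ x Y * θ x (fderiv ℝ (fun y => s y (ψ y)) x (horizontalPart s ψ X x))
          (horizontalPart s ψ X x)) := by
  filter_upwards [h.fderiv_θ_u, h.fderiv_θ_antisymm, h.fderiv_θ_horizontal, h.ψ_horizontalPart,
    h.κ_horizontalPart, h.θ_horizontalPart, h.θ_antisymm] with x h1 h2 h3 h4 h5 h6 h7 X Y
  have e1 := h1 (horizontalPart s ψ X x) Y
  have e2 := h1 (horizontalPart s ψ X x) (horizontalPart s ψ X x)
  have e3 := h2 (horizontalPart s ψ X x) (horizontalPart s ψ X x) (s x (ψ x))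
  -- Repeating the direction `X` kills the term with `θ X X`. The other two `κ` terms coincide by
  -- antisymmetry and leave only `2 θ(X, Y) κ(X)`.
  have e4 := h3 (horizontalPart s ψ X x) (horizontalPart s ψ X x) (horizontalPart s ψ Y x)
    (h4 X) (h4 X) (h4 Y)
  have t : ∀ v w, θ x (horizontalPart s ψ v x) (horizontalPart s ψ w x) = θ x v w := by
    intro v w
    rw [h6, h7, h6, h7 w v]
    ring
  have t2 := h7 X X
  rw [t, t, t, h5, h5, h7 Y X] at e4
  conv at e3 => rhs; rw [e2]
  have e5 : fderiv ℝ θ x (horizontalPart s ψ X x) X Y =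
      fderiv ℝ θ x (horizontalPart s ψ X x) (horizontalPart s ψ X x) (horizontalPart s ψ Y x)
      + ψ x X * fderiv ℝ θ x (horizontalPart s ψ X x) (s x (ψ x)) Y
      + ψ x Y * fderiv ℝ θ x (horizontalPart s ψ X x) (horizontalPart s ψ X x) (s x (ψ x)) := by
    generalize fderiv ℝ θ x (horizontalPart s ψ X x) = L
    simp only [horizontalPart, map_sub, map_smul, _root_.sub_apply, _root_.smul_apply,
      smul_eq_mul]
    ring
  linear_combination e5 + (1 / 2) * e4 + ψ x X * e1 + ψ x Y * e3 - κ x Y / 2 * t2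

theorem controlled_fderiv_u_horizontal [FiniteDimensional ℝ E] (h : IsRigidTriple p s γ ψ θ κ)
    (h' : IsRigidTriple p s γ ψ' θ' κ') (hs : ContDiffAt ℝ ∞ s p) (hγ : ContDiffAt ℝ ∞ γ p)
    (cψ : Controlled p δ ψ ψ') (cθ : Controlled p δ θ θ') (X : E) :
    Controlled p δ (fun x => fderiv ℝ (fun y => s y (ψ y)) x (horizontalPart s ψ X x))
      (fun x => fderiv ℝ (fun y => s y (ψ' y)) x (horizontalPart s ψ' X x)) :=
  controlled_fderiv_clm_apply hs cψ (controlled_horizontalPart hs cψ X)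
    (controlled_fderiv_ψ_horizontal h h' hs hγ cψ cθ X)

theorem controlled_fderiv_Γ_horizontal [FiniteDimensional ℝ E] (h : IsRigidTriple p s γ ψ θ κ)
    (h' : IsRigidTriple p s γ ψ' θ' κ') (hs : ContDiffAt ℝ ∞ s p) (hγ : ContDiffAt ℝ ∞ γ p)
    (cψ : Controlled p δ ψ ψ') (cθ : Controlled p δ θ θ') (X : E) :
    Controlled p δ (fun x => fderiv ℝ (fun y => γ y (ψ y)) x (horizontalPart s ψ X x))
      (fun x => fderiv ℝ (fun y => γ y (ψ' y)) x (horizontalPart s ψ' X x)) :=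
  controlled_fderiv_clm_apply hγ cψ (controlled_horizontalPart hs cψ X)
    (controlled_fderiv_ψ_horizontal h h' hs hγ cψ cθ X)

/-- Once `2 θ(X, Y) κ(X)` is removed, the remainder involves only `ψ`, `θ` and the horizontal
derivatives of `ψ`, so control of `κ` is not required. -/
theorem controlled_fderiv_θ_sectional [FiniteDimensional ℝ E] (h : IsRigidTriple p s γ ψ θ κ)
    (h' : IsRigidTriple p s γ ψ' θ' κ') (hs : ContDiffAt ℝ ∞ s p) (hγ : ContDiffAt ℝ ∞ γ p)
    (cψ : Controlled p δ ψ ψ') (cθ : Controlled p δ θ θ') (X Y : E) :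
    Controlled p δ
      (fun x => fderiv ℝ θ x (horizontalPart s ψ X x) X Y - 2 * (θ x X Y * κ x X))
      (fun x => fderiv ℝ θ' x (horizontalPart s ψ' X x) X Y - 2 * (θ' x X Y * κ' x X)) := by
  have cX := controlled_horizontalPart hs cψ (δ := δ)
  have cΓ := controlled_fderiv_Γ_horizontal h h' hs hγ cψ cθ
  have cθu := cθ.clm_apply (controlled_fderiv_u_horizontal h h' hs hγ cψ cθ X)
  have cψX := fun X => cψ.clm_apply (Controlled.const X)
  refine ((((((cΓ X).clm_apply (cX Y)).clm_apply (cX X)).sub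
    (((cΓ Y).clm_apply (cX X)).clm_apply (cX X))).sub
    ((cψX X).mul (cθu.clm_apply (Controlled.const Y)))).add
    ((cψX Y).mul (cθu.clm_apply (cX X)))).congr ?_ ?_
  · filter_upwards [h.fderiv_θ_sectional] with x h1
    rw [h1]
    ring
  · filter_upwards [h'.fderiv_θ_sectional] with x h1
    rw [h1]
    ring

/-- The horizontal derivative of the acceleration is that of the vorticity along the flow, up to
lower order terms. -/
theorem controlled_fderiv_κ_sub [FiniteDimensional ℝ E] (h : IsRigidTriple p s γ ψ θ κ)
    (h' : IsRigidTriple p s γ ψ' θ' κ') (hs : ContDiffAt ℝ ∞ s p) (hγ : ContDiffAt ℝ ∞ γ p)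
    (cψ : Controlled p δ ψ ψ') (cθ : Controlled p δ θ θ') (cκ : Controlled p δ κ κ') (X Y : E) :
    Controlled p δ
      (fun x => fderiv ℝ κ x (horizontalPart s ψ X x) Y - fderiv ℝ θ x (s x (ψ x)) X Y)
      (fun x => fderiv ℝ κ' x (horizontalPart s ψ' X x) Y - fderiv ℝ θ' x (s x (ψ' x)) X Y) := by
  have cX := controlled_horizontalPart hs cψ (δ := δ)
  have cu := controlled_u hs cψ
  have cΓ := controlled_fderiv_Γ_horizontal h h' hs hγ cψ cθ X
  have cDψu := (controlled_fderiv_ψ h h' hγ cψ cθ cκ).clm_apply cu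
  have cΓu := controlled_fderiv_clm_apply hγ cψ cu cDψu
  have cuu := controlled_fderiv_clm_apply hs cψ cu cDψu
  have cDu := controlled_fderiv_u_horizontal h h' hs hγ cψ cθ X
  have cθu := cθ.clm_apply cDu
  have cY := Controlled.const (δ := δ) (p := p) Y
  have cψX := cψ.clm_apply (Controlled.const X)
  refine ((((((cΓu.clm_apply (cX X)).clm_apply cY).sub ((cΓ.clm_apply cu).clm_apply cY)).add
    ((cκ.clm_apply (Controlled.const X)).mul (cκ.clm_apply cY))).add
      (cθu.clm_apply cY)).add
      (cψX.mul ((cθ.clm_apply cuu).clm_apply cY))).congr ?_ ?_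
  · filter_upwards [h.fderiv_κ_horizontal, h.ψ_horizontalPart, h.κ_horizontalPart,
      h.fderiv_θ_u] with x h1 h2 h3 h4
    have e := h4 (s x (ψ x)) Y
    rw [h1 _ _ (h2 X), h3]
    have e5 : fderiv ℝ θ x (s x (ψ x)) (horizontalPart s ψ X x) Y = fderiv ℝ θ x (s x (ψ x)) X Y
        - ψ x X * fderiv ℝ θ x (s x (ψ x)) (s x (ψ x)) Y := by
      simp [horizontalPart]
    linear_combination e5 - ψ x X * e
  · filter_upwards [h'.fderiv_κ_horizontal, h'.ψ_horizontalPart, h'.κ_horizontalPart,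
      h'.fderiv_θ_u] with x h1 h2 h3 h4
    have e := h4 (s x (ψ' x)) Y
    rw [h1 _ _ (h2 X), h3]
    have e5 : fderiv ℝ θ' x (s x (ψ' x)) (horizontalPart s ψ' X x) Y =
        fderiv ℝ θ' x (s x (ψ' x)) X Y
        - ψ' x X * fderiv ℝ θ' x (s x (ψ' x)) (s x (ψ' x)) Y := by
      simp [horizontalPart]
    linear_combination e5 - ψ' x X * e

/-- The component of the Lie bracket of two horizontal fields along the flow. -/
theorem ψ_bracket (h : IsRigidTriple p s γ ψ θ κ) (X Y : E) : ∀ᶠ x in 𝓝 p,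
    ψ x (fderiv ℝ (horizontalPart s ψ Y) x (horizontalPart s ψ X x)
      - fderiv ℝ (horizontalPart s ψ X) x (horizontalPart s ψ Y x)) = -2 * θ x X Y := by
  -- Differentiating `ψ = 0` on the horizontal field moves the derivative onto `ψ`. The bracket then
  -- sees the antisymmetrised derivative of `ψ` on horizontal vectors, where the Christoffel term
  -- cancels and `θ` counts twice.
  have hd : ∀ X, ∀ᶠ x in 𝓝 p, ∀ v, ψ x (fderiv ℝ (horizontalPart s ψ X) x v) =
      -fderiv ℝ ψ x v (horizontalPart s ψ X x) := by
    intro X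
    have hX : ContDiffAt ℝ ∞ (horizontalPart s ψ X) p :=
      contDiffAt_const.sub ((h.smooth_ψ.clm_apply contDiffAt_const).smul h.smooth_u)
    filter_upwards [h.ψ_horizontalPart.eventually_nhds, eventually_differentiableAt h.smooth_ψ,
      eventually_differentiableAt hX] with x hx dψ dX v
    have d := dψ.hasFDerivAt.clm_apply dX.hasFDerivAt
    have e : (fun y => ψ y (horizontalPart s ψ X y)) =ᶠ[𝓝 x] fun _ => 0 := by
      filter_upwards [hx] with y hy using hy X
    have := congrArg (fun L => L v) (d.fderiv.symm.trans e.fderiv_eq)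
    simp at this
    linarith
  filter_upwards [hd X, hd Y, h.fderiv_ψ, h.Γ_symm, h.θ_antisymm, h.ψ_horizontalPart,
    h.θ_horizontalPart] with x h1 h2 h3 h4 h5 h6 h7
  have t : ∀ v w, θ x (horizontalPart s ψ v x) (horizontalPart s ψ w x) = θ x v w := by
    intro v w
    rw [h7, h5, h7, h5 w v]
    ring
  rw [map_sub, h1, h2, h3, h3, h6, h6, h4 (horizontalPart s ψ Y x), t, t, h5 Y X]
  ring

/-- If the derivatives of `j` along horizontal fields are controlled, so is the derivative of `j`
along any field minus its component along the flow. -/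
theorem controlled_fderiv_horizontal [FiniteDimensional ℝ E] {j j' : E → F} {v v' : E → E}
    (cj : ∀ X, Controlled p δ (fun x => fderiv ℝ j x (horizontalPart s ψ X x))
      (fun x => fderiv ℝ j' x (horizontalPart s ψ' X x))) (cv : Controlled p δ v v') :
    Controlled p δ (fun x => fderiv ℝ j x (v x) - ψ x (v x) • fderiv ℝ j x (s x (ψ x)))
      (fun x => fderiv ℝ j' x (v' x) - ψ' x (v' x) • fderiv ℝ j' x (s x (ψ' x))) := by
  have c : Controlled p δ
      (fun x => fderiv ℝ j x - (ψ x).smulRight (fderiv ℝ j x (s x (ψ x))))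
      (fun x => fderiv ℝ j' x - (ψ' x).smulRight (fderiv ℝ j' x (s x (ψ' x)))) := by
    refine clm_of_apply fun X => (cj X).congr ?_ ?_ <;>
    exact Filter.Eventually.of_forall fun x => by simp [horizontalPart]
  simpa using c.clm_apply cv

end IsRigidTriple
end Closure

/-! ### The commutator identity for the vorticity -/

section LocalUniqueness

variable {E F G : Type*} [NormedAddCommGroup E] [NormedSpace ℝ E]
  [NormedAddCommGroup F] [NormedSpace ℝ F] [NormedAddCommGroup G] [NormedSpace ℝ G]
  {p : E} {s : E → (E →L[ℝ] ℝ) →L[ℝ] E}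
  {γ : E → (E →L[ℝ] ℝ) →L[ℝ] E →L[ℝ] E →L[ℝ] ℝ}
  {ψ ψ' κ κ' : E → E →L[ℝ] ℝ} {θ θ' : E → E →L[ℝ] E →L[ℝ] ℝ}
  {D : Type*} [NormedAddCommGroup D] [NormedSpace ℝ D] {δ : E → D}

theorem Controlled.prodMk {q q' : E → F} {r r' : E → G} (h : Controlled p δ q q')
    (k : Controlled p δ r r') :
    Controlled p δ (fun x => (q x, r x)) (fun x => (q' x, r' x)) := by
  simpa using (h.clm_comp_const (ContinuousLinearMap.inl ℝ F G)).add
    (k.clm_comp_const (ContinuousLinearMap.inr ℝ F G))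

theorem Controlled.fderiv_prodMk_apply {q q' : E → F} {r r' : E → G} {a a' : E → E}
    (hq : ContDiffAt ℝ ∞ q p) (hq' : ContDiffAt ℝ ∞ q' p)
    (hr : ContDiffAt ℝ ∞ r p) (hr' : ContDiffAt ℝ ∞ r' p)
    (h : Controlled p δ (fun x => fderiv ℝ q x (a x)) (fun x => fderiv ℝ q' x (a' x)))
    (k : Controlled p δ (fun x => fderiv ℝ r x (a x)) (fun x => fderiv ℝ r' x (a' x))) :
    Controlled p δ (fun x => fderiv ℝ (fun y => (q y, r y)) x (a x))
      (fun x => fderiv ℝ (fun y => (q' y, r' y)) x (a' x)) := by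
  refine (h.prodMk k).congr ?_ ?_
  · filter_upwards [eventually_differentiableAt hq, eventually_differentiableAt hr] with x h1 h2
    rw [(h1.hasFDerivAt.prodMk h2.hasFDerivAt).fderiv]
    simp
  · filter_upwards [eventually_differentiableAt hq', eventually_differentiableAt hr'] with x h1 h2
    rw [(h1.hasFDerivAt.prodMk h2.hasFDerivAt).fderiv]
    simp

namespace IsRigidTriple

open Controlled

/-- A quantity depending on `ψ` and `θ` has controlled horizontal derivatives. -/
theorem controlled_fderiv_apply_of_ψ_θ [FiniteDimensional ℝ E] {q q' : E → F}
    (h : IsRigidTriple p s γ ψ θ κ)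
    (h' : IsRigidTriple p s γ ψ' θ' κ') (hs : ContDiffAt ℝ ∞ s p) (hγ : ContDiffAt ℝ ∞ γ p)
    (cψ : Controlled p δ ψ ψ') (cθ : Controlled p δ θ θ') (cκ : Controlled p δ κ κ')
    (hq : Controlled p (fun x => (ψ' x, θ' x) - (ψ x, θ x)) q q') (X : E) :
    Controlled p δ (fun x => fderiv ℝ q x (horizontalPart s ψ X x))
      (fun x => fderiv ℝ q' x (horizontalPart s ψ' X x)) :=
  hq.fderiv_apply (cψ.prodMk cθ) (controlled_horizontalPart hs cψ X)
    (fderiv_prodMk_apply cψ.left cψ.right cθ.left cθ.right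
      (controlled_fderiv_ψ_horizontal h h' hs hγ cψ cθ X)
      (controlled_fderiv_θ_horizontal h h' hs hγ cψ cθ cκ X))

theorem fderiv_two_mul_add {w κ f : E → ℝ} (hw : ContDiffAt ℝ ∞ w p) (hκ : ContDiffAt ℝ ∞ κ p)
    (hf : ContDiffAt ℝ ∞ f p) : ∀ᶠ x in 𝓝 p, ∀ v, fderiv ℝ (fun y => 2 * (w y * κ y) + f y) x v
      = 2 * (fderiv ℝ w x v * κ x + w x * fderiv ℝ κ x v) + fderiv ℝ f x v := by
  filter_upwards [eventually_differentiableAt hw, eventually_differentiableAt hκ,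
    eventually_differentiableAt hf] with x dw dκ df v
  have d : HasFDerivAt (fun y => 2 * (w y * κ y) + f y) _ x :=
    ((dw.hasFDerivAt.mul dκ.hasFDerivAt).const_mul 2).add df.hasFDerivAt
  rw [d.fderiv]
  simp
  ring

theorem fderiv_clm_apply_const {q : E → F →L[ℝ] G} (hq : ContDiffAt ℝ ∞ q p) (X : F) :
    ∀ᶠ x in 𝓝 p, ∀ v, fderiv ℝ (fun y => q y X) x v = fderiv ℝ q x v X := by
  filter_upwards [eventually_differentiableAt hq] with x dq v
  rw [(dq.hasFDerivAt.clm_apply (hasFDerivAt_const X x)).fderiv]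
  simp

/-- The commutator identity for the component `θ X Y` of the vorticity. -/
theorem commutator_θ (h : IsRigidTriple p s γ ψ θ κ) (X Y : E) {f₁ f₂ : E → ℝ}
    (hf₁ : ContDiffAt ℝ ∞ f₁ p) (hf₂ : ContDiffAt ℝ ∞ f₂ p)
    (e₁ : ∀ᶠ x in 𝓝 p, fderiv ℝ θ x (horizontalPart s ψ X x) X Y =
      2 * (θ x X Y * κ x X) + f₁ x)
    (e₂ : ∀ᶠ x in 𝓝 p, fderiv ℝ θ x (horizontalPart s ψ Y x) X Y =
      2 * (θ x X Y * κ x Y) + f₂ x) : ∀ᶠ x in 𝓝 p,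
    2 * (fderiv ℝ θ x (horizontalPart s ψ X x) X Y * κ x Y
        + θ x X Y * fderiv ℝ κ x (horizontalPart s ψ X x) Y)
      + fderiv ℝ f₂ x (horizontalPart s ψ X x)
    - (2 * (fderiv ℝ θ x (horizontalPart s ψ Y x) X Y * κ x X
        + θ x X Y * fderiv ℝ κ x (horizontalPart s ψ Y x) X)
      + fderiv ℝ f₁ x (horizontalPart s ψ Y x)) =
    fderiv ℝ θ x (fderiv ℝ (horizontalPart s ψ Y) x (horizontalPart s ψ X x)
      - fderiv ℝ (horizontalPart s ψ X) x (horizontalPart s ψ Y x)) X Y := by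
  have hw : ContDiffAt ℝ ∞ (fun x => θ x X Y) p :=
    (h.smooth_θ.clm_apply contDiffAt_const).clm_apply contDiffAt_const
  have hκ : ∀ X, ContDiffAt ℝ ∞ (fun x => κ x X) p := fun X =>
    h.smooth_κ.clm_apply contDiffAt_const
  have hX : ∀ X, ContDiffAt ℝ ∞ (horizontalPart s ψ X) p := fun X =>
    contDiffAt_const.sub ((h.smooth_ψ.clm_apply contDiffAt_const).smul h.smooth_u)
  have dw : ∀ᶠ x in 𝓝 p, ∀ v, fderiv ℝ (fun y => θ y X Y) x v = fderiv ℝ θ x v X Y := by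
    filter_upwards [fderiv_clm_apply_const h.smooth_θ X,
      fderiv_clm_apply_const (h.smooth_θ.clm_apply contDiffAt_const) Y] with x h1 h2 v
    rw [h2, h1]
  filter_upwards [fderiv_fderiv_sub_eq hw (hX X) (hX Y), dw.eventually_nhds,
    fderiv_two_mul_add hw (hκ X) hf₁, fderiv_two_mul_add hw (hκ Y) hf₂,
    fderiv_clm_apply_const h.smooth_κ X, fderiv_clm_apply_const h.smooth_κ Y,
    e₁.eventually_nhds, e₂.eventually_nhds] with x h1 h2 h3 h4 h5 h6 h7 h8
  have g1 : (fun y => fderiv ℝ (fun y => θ y X Y) y (horizontalPart s ψ X y)) =ᶠ[𝓝 x]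
      fun y => 2 * (θ y X Y * κ y X) + f₁ y := by
    filter_upwards [h2, h7] with y k1 k2
    rw [k1, k2]
  have g2 : (fun y => fderiv ℝ (fun y => θ y X Y) y (horizontalPart s ψ Y y)) =ᶠ[𝓝 x]
      fun y => 2 * (θ y X Y * κ y Y) + f₂ y := by
    filter_upwards [h2, h8] with y k1 k2
    rw [k1, k2]
  have h2 := h2.self_of_nhds
  rw [g1.fderiv_eq, g2.fderiv_eq, h3, h4, h2, h2, h2, h5, h6] at h1
  exact h1

/-- The derivative of the vorticity along the flow is controlled, after multiplication by the
vorticity. -/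
theorem controlled_θ_mul_fderiv_θ [FiniteDimensional ℝ E] (h : IsRigidTriple p s γ ψ θ κ)
    (h' : IsRigidTriple p s γ ψ' θ' κ') (hs : ContDiffAt ℝ ∞ s p) (hγ : ContDiffAt ℝ ∞ γ p)
    (cψ : Controlled p δ ψ ψ') (cθ : Controlled p δ θ θ') (cκ : Controlled p δ κ κ') (X Y : E) :
    Controlled p δ (fun x => θ x X Y • fderiv ℝ θ x (s x (ψ x)) X Y)
      (fun x => θ' x X Y • fderiv ℝ θ' x (s x (ψ' x)) X Y) := by
  -- The remainders are controlled here by the defect of `(ψ, θ)` alone, not by `δ`. A dependence on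
  -- `κ` would, after one more horizontal derivative, bring in derivatives of `κ` that are not yet
  -- controlled.
  have c0 := Controlled.self (h.smooth_ψ.prodMk h.smooth_θ) (h'.smooth_ψ.prodMk h'.smooth_θ)
  have cψ0 := c0.clm_comp_const (ContinuousLinearMap.fst ℝ _ _)
  have cθ0 := c0.clm_comp_const (ContinuousLinearMap.snd ℝ _ _)
  simp only [ContinuousLinearMap.coe_fst', ContinuousLinearMap.coe_snd'] at cψ0 cθ0
  have cf₁ := controlled_fderiv_θ_sectional h h' hs hγ cψ0 cθ0 X Y
  have cf₂ := (controlled_fderiv_θ_sectional h h' hs hγ cψ0 cθ0 Y X).neg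
  have df₁ := controlled_fderiv_apply_of_ψ_θ h h' hs hγ cψ cθ cκ cf₁ Y
  have df₂ := controlled_fderiv_apply_of_ψ_θ h h' hs hγ cψ cθ cκ cf₂ X
  have cX := controlled_horizontalPart hs cψ (δ := δ)
  have cDX := fun X Y : E => controlled_fderiv_apply_of_ψ_θ h h' hs hγ cψ cθ cκ
    (controlled_horizontalPart hs cψ0 Y) X
  have cb := (cDX X Y).sub (cDX Y X)
  have cθh := controlled_fderiv_θ_horizontal h h' hs hγ cψ cθ cκ
  have cθb := controlled_fderiv_horizontal (j := θ) (j' := θ') cθh cb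
  have cc := fun X : E => Controlled.const (δ := δ) (p := p) X
  have cw := (cθ.clm_apply (cc X)).clm_apply (cc Y)
  have cκX := fun X : E => cκ.clm_apply (cc X)
  have cκs := controlled_fderiv_κ_sub h h' hs hγ cψ cθ cκ
  -- all the lower order terms of the commutator identity
  refine (((((((cθb.clm_apply (cc X)).clm_apply (cc Y)).sub df₂).add df₁).sub
    ((((cθh X).clm_apply (cc X)).clm_apply (cc Y)).smul (cκX Y) |>.clm_comp_const
      ((2 : ℝ) • ContinuousLinearMap.id ℝ ℝ))).add
    ((((cθh Y).clm_apply (cc X)).clm_apply (cc Y)).smul (cκX X) |>.clm_comp_const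
      ((2 : ℝ) • ContinuousLinearMap.id ℝ ℝ))).sub
    ((cw.mul ((cκs X Y).sub (cκs Y X))).clm_comp_const
      ((2 : ℝ) • ContinuousLinearMap.id ℝ ℝ)) |>.clm_comp_const
      -- Six is 2 + 4: the flow component of the bracket contributes 2, and the antisymmetrised
      -- horizontal derivative of `κ` contributes the flow derivative of `θ` twice, with a prefactor
      -- 2.
      ((1 / 6 : ℝ) • ContinuousLinearMap.id ℝ ℝ)).congr ?_ ?_
  · filter_upwards [h.commutator_θ X Y cf₁.left cf₂.left
      (Filter.Eventually.of_forall fun x => by ring) (by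
        filter_upwards [h.θ_antisymm, h.fderiv_θ_antisymm] with x k1 k2
        rw [k1 X Y, k2 _ X Y]; ring), h.ψ_bracket X Y, h.fderiv_θ_antisymm] with x h1 h2 h3
    simp only [_root_.smul_apply, ContinuousLinearMap.id_apply, smul_eq_mul, _root_.sub_apply, h2]
    rw [h3 (s x (ψ x)) Y X]
    linear_combination (1 / 6) * h1
  · filter_upwards [h'.commutator_θ X Y cf₁.right cf₂.right
      (Filter.Eventually.of_forall fun x => by ring) (by
        filter_upwards [h'.θ_antisymm, h'.fderiv_θ_antisymm] with x k1 k2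
        rw [k1 X Y, k2 _ X Y]; ring), h'.ψ_bracket X Y, h'.fderiv_θ_antisymm] with x h1 h2 h3
    simp only [_root_.smul_apply, ContinuousLinearMap.id_apply, smul_eq_mul, _root_.sub_apply, h2]
    rw [h3 (s x (ψ' x)) Y X]
    linear_combination (1 / 6) * h1

end IsRigidTriple
end LocalUniqueness

/-! ### The closed differential system and local uniqueness -/

section LocalUniqueness

variable {E : Type*} [NormedAddCommGroup E] [NormedSpace ℝ E] [FiniteDimensional ℝ E]
  {p : E} {s : E → (E →L[ℝ] ℝ) →L[ℝ] E}
  {γ : E → (E →L[ℝ] ℝ) →L[ℝ] E →L[ℝ] E →L[ℝ] ℝ}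
  {ψ ψ' κ κ' : E → E →L[ℝ] ℝ} {θ θ' : E → E →L[ℝ] E →L[ℝ] ℝ}
  {D : Type*} [NormedAddCommGroup D] [NormedSpace ℝ D] {δ : E → D}

namespace IsRigidTriple

open Controlled

/-- Where the vorticity does not vanish, its derivative along the flow is controlled. -/
theorem controlled_fderiv_θ_u (h : IsRigidTriple p s γ ψ θ κ)
    (h' : IsRigidTriple p s γ ψ' θ' κ') (hs : ContDiffAt ℝ ∞ s p) (hγ : ContDiffAt ℝ ∞ γ p)
    (cψ : Controlled p δ ψ ψ') (cθ : Controlled p δ θ θ') (cκ : Controlled p δ κ κ')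
    (hθ : θ p = θ' p) (h0 : ∃ X Y, θ p X Y ≠ 0) (X Y : E) :
    Controlled p δ (fun x => fderiv ℝ θ x (s x (ψ x)) X Y)
      (fun x => fderiv ℝ θ' x (s x (ψ' x)) X Y) := by
  have k1 : ∀ X Y, θ p X Y ≠ 0 → Controlled p δ (fun x => fderiv ℝ θ x (s x (ψ x)) X Y)
      (fun x => fderiv ℝ θ' x (s x (ψ' x)) X Y) := fun X Y hXY =>
    ((cθ.clm_apply (Controlled.const X)).clm_apply (Controlled.const Y)).of_mul_left hXY
      (by rwa [← hθ]) (controlled_θ_mul_fderiv_θ h h' hs hγ cψ cθ cκ X Y)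
  -- A component that vanishes at `p` is the difference of two that do not: add to one of its
  -- arguments a vector that makes the component nonzero. This is applied first in the second
  -- argument, then in the first.
  have k2 : ∀ X Y, θ p X Y ≠ 0 → ∀ Z, Controlled p δ (fun x => fderiv ℝ θ x (s x (ψ x)) X Z)
      (fun x => fderiv ℝ θ' x (s x (ψ' x)) X Z) := by
    intro X Y hXY Z
    by_cases hZ : θ p X Z = 0
    · have := (k1 X (Y + Z) (by simpa [hZ] using hXY)).sub (k1 X Y hXY)
      simpa using this
    · exact k1 X Z hZ
  obtain ⟨X₀, Y₀, h0⟩ := h0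
  by_cases hX : ∃ Z, θ p X Z ≠ 0
  · obtain ⟨Z, hZ⟩ := hX
    exact k2 X Z hZ Y
  · push Not at hX
    have := (k2 (X₀ + X) Y₀ (by simpa [hX] using h0) Y).sub (k2 X₀ Y₀ h0 Y)
    simpa using this

theorem controlled_fderiv_κ_horizontal (h : IsRigidTriple p s γ ψ θ κ)
    (h' : IsRigidTriple p s γ ψ' θ' κ') (hs : ContDiffAt ℝ ∞ s p) (hγ : ContDiffAt ℝ ∞ γ p)
    (cψ : Controlled p δ ψ ψ') (cθ : Controlled p δ θ θ') (cκ : Controlled p δ κ κ')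
    (hθ : θ p = θ' p) (h0 : ∃ X Y, θ p X Y ≠ 0) (X : E) :
    Controlled p δ (fun x => fderiv ℝ κ x (horizontalPart s ψ X x))
      (fun x => fderiv ℝ κ' x (horizontalPart s ψ' X x)) := by
  refine clm_of_apply fun Y => ?_
  simpa using (controlled_fderiv_κ_sub h h' hs hγ cψ cθ cκ X Y).add
    (controlled_fderiv_θ_u h h' hs hγ cψ cθ cκ hθ h0 X Y)

/-- A rigid flow is determined near a point where it has vorticity by its first derivatives at that
point. -/
theorem eventually_eq (h : IsRigidTriple p s γ ψ θ κ)
    (h' : IsRigidTriple p s γ ψ' θ' κ') (hs : ContDiffAt ℝ ∞ s p) (hγ : ContDiffAt ℝ ∞ γ p)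
    (hψ : ψ p = ψ' p) (hθ : θ p = θ' p) (hκ : κ p = κ' p) (h0 : ∃ X Y, θ p X Y ≠ 0) :
    ∀ᶠ x in 𝓝 p, ψ x = ψ' x := by
  let j : E → (E →L[ℝ] ℝ) × (E →L[ℝ] E →L[ℝ] ℝ) × (E →L[ℝ] ℝ) := fun x => (ψ x, θ x, κ x)
  let j' : E → (E →L[ℝ] ℝ) × (E →L[ℝ] E →L[ℝ] ℝ) × (E →L[ℝ] ℝ) := fun x => (ψ' x, θ' x, κ' x)
  have hj : ContDiffAt ℝ ∞ j p := h.smooth_ψ.prodMk (h.smooth_θ.prodMk h.smooth_κ)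
  have hj' : ContDiffAt ℝ ∞ j' p := h'.smooth_ψ.prodMk (h'.smooth_θ.prodMk h'.smooth_κ)
  have cj := Controlled.self hj hj'
  have cψ : Controlled p (fun x => j' x - j x) ψ ψ' :=
    cj.clm_comp_const (ContinuousLinearMap.fst ℝ _ _)
  have cθκ := cj.clm_comp_const (ContinuousLinearMap.snd ℝ _ _)
  have cθ : Controlled p (fun x => j' x - j x) θ θ' :=
    cθκ.clm_comp_const (ContinuousLinearMap.fst ℝ _ _)
  have cκ : Controlled p (fun x => j' x - j x) κ κ' :=
    cθκ.clm_comp_const (ContinuousLinearMap.snd ℝ _ _)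
  -- the horizontal derivatives
  have dψ := controlled_fderiv_ψ_horizontal h h' hs hγ cψ cθ
  have dθ := controlled_fderiv_θ_horizontal h h' hs hγ cψ cθ cκ
  have dκ := controlled_fderiv_κ_horizontal h h' hs hγ cψ cθ cκ hθ h0
  have dj : ∀ X, Controlled p (fun x => j' x - j x)
      (fun x => fderiv ℝ j x (horizontalPart s ψ X x))
      (fun x => fderiv ℝ j' x (horizontalPart s ψ' X x)) := fun X =>
    fderiv_prodMk_apply cψ.left cψ.right (cθ.left.prodMk cκ.left) (cθ.right.prodMk cκ.right)
      (dψ X) (fderiv_prodMk_apply cθ.left cθ.right cκ.left cκ.right (dθ X) (dκ X))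
  -- the derivatives along the flow
  have cX := controlled_horizontalPart hs cψ
  have cu := controlled_u hs cψ
  have ddκ := fun X Y => (dκ Y).fderiv_apply cj (cX X) (dj X)
  have ddX := fun X Y => (cX Y).fderiv_apply cj (cX X) (dj X)
  have cb := fun X Y => (ddX X Y).sub (ddX Y X)
  have cκb := fun X Y => controlled_fderiv_horizontal (j := κ) (j' := κ') dκ (cb X Y)
  obtain ⟨X, Y, h0'⟩ := h0
  -- The commutator of two horizontal derivatives of `κ` is its derivative along the bracket, whose
  -- flow component is `-2 θ(X, Y)`. Isolating that component gives `2 θ(X, Y)` times the flow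
  -- derivative, hence the factor 1/2 and the division.
  have dκu : Controlled p (fun x => j' x - j x) (fun x => fderiv ℝ κ x (s x (ψ x)))
      (fun x => fderiv ℝ κ' x (s x (ψ' x))) := by
    refine ((cθ.clm_apply (Controlled.const X)).clm_apply (Controlled.const Y)).of_mul_left h0'
      (by rwa [← hθ]) (((((cκb X Y).sub (ddκ X Y)).add (ddκ Y X)).clm_comp_const
        ((1 / 2 : ℝ) • ContinuousLinearMap.id ℝ (E →L[ℝ] ℝ))).congr ?_ ?_)
    · filter_upwards [fderiv_fderiv_sub_eq cκ.left (cX X).left (cX Y).left, h.ψ_bracket X Y]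
        with x h1 h2
      rw [h2, ← h1]
      simp only [_root_.smul_apply, ContinuousLinearMap.id_apply]
      module
    · filter_upwards [fderiv_fderiv_sub_eq cκ.right (cX X).right (cX Y).right, h'.ψ_bracket X Y]
        with x h1 h2
      rw [h2, ← h1]
      simp only [_root_.smul_apply, ContinuousLinearMap.id_apply]
      module
  have dθu : Controlled p (fun x => j' x - j x) (fun x => fderiv ℝ θ x (s x (ψ x)))
      (fun x => fderiv ℝ θ' x (s x (ψ' x))) := clm_of_apply fun X => clm_of_apply fun Y =>
    controlled_fderiv_θ_u h h' hs hγ cψ cθ cκ hθ ⟨_, _, h0'⟩ X Y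
  have dju : Controlled p (fun x => j' x - j x) (fun x => fderiv ℝ j x (s x (ψ x)))
      (fun x => fderiv ℝ j' x (s x (ψ' x))) :=
    fderiv_prodMk_apply cψ.left cψ.right (cθ.left.prodMk cκ.left) (cθ.right.prodMk cκ.right)
      ((controlled_fderiv_ψ h h' hγ cψ cθ cκ).clm_apply cu)
      (fderiv_prodMk_apply cθ.left cθ.right cκ.left cκ.right dθu dκu)
  have dj_all : Controlled p (fun x => j' x - j x) (fderiv ℝ j) (fderiv ℝ j') := by
    -- A constant vector is its horizontal part plus `ψ X` times the velocity.
    refine clm_of_apply fun X => ((dj X).add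
      ((cψ.clm_apply (Controlled.const X)).smul dju)).congr ?_ ?_ <;>
    exact Filter.Eventually.of_forall fun x => by simp [horizontalPart]
  obtain ⟨C, hC, hCe⟩ := dj_all.exists_coeff
  have hz : ∀ᶠ x in 𝓝 p, j' x - j x = 0 := by
    refine eventually_eq_zero_of_fderiv_eq (C := C) ?_ hC.continuousAt ?_ ?_
    · filter_upwards [eventually_differentiableAt hj, eventually_differentiableAt hj']
        with x h1 h2 using h2.sub h1
    · filter_upwards [eventually_differentiableAt hj, eventually_differentiableAt hj', hCe]
        with x h1 h2 h3
      rw [← h3]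
      exact (h2.hasFDerivAt.sub h1.hasFDerivAt).fderiv
    · simp [j, j', hψ, hθ, hκ]
  filter_upwards [hz] with x hx
  exact (congrArg Prod.fst (sub_eq_zero.1 hx)).symm

end IsRigidTriple
end LocalUniqueness

/-! ### Coordinate expressions -/

section Coordinates

variable {E E' : Type*} [NormedAddCommGroup E] [NormedSpace ℝ E]
  [NormedAddCommGroup E'] [NormedSpace ℝ E']

/-- The Christoffel symbols of the first kind of the metric `g`: the number `g(Γ(a, b), v)`. -/
noncomputable def christoffel (g : E → E →L[ℝ] E →L[ℝ] ℝ) (x : E) :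
    E →L[ℝ] E →L[ℝ] E →L[ℝ] ℝ :=
  (1 / 2 : ℝ) • ((fderiv ℝ g x).flip +
    (ContinuousLinearMap.flipₗᵢ ℝ E E ℝ).toContinuousLinearEquiv.toContinuousLinearMap.comp
      (fderiv ℝ g x).flip - fderiv ℝ g x)

theorem christoffel_apply (g : E → E →L[ℝ] E →L[ℝ] ℝ) (x v a b : E) : christoffel g x v a b =
    (1 / 2) * (fderiv ℝ g x a v b + fderiv ℝ g x b v a - fderiv ℝ g x v a b) := by
  simp [christoffel]

theorem contDiffAt_christoffel {g : E → E →L[ℝ] E →L[ℝ] ℝ} {p : E} (hg : ContDiffAt ℝ ∞ g p) :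
    ContDiffAt ℝ ∞ (christoffel g) p := by
  have h1 := Controlled.fderiv_smooth hg
  have h2 : ContDiffAt ℝ ∞ (fun x => (fderiv ℝ g x).flip) p :=
    (ContinuousLinearMap.flipₗᵢ ℝ E E (E →L[ℝ] ℝ)).contDiff.contDiffAt.comp p h1
  exact (((h2.add (contDiffAt_const.clm_comp h2)).sub h1).const_smul (1 / 2 : ℝ))

/-- The differential form dual to the vector field `u`. -/
noncomputable def dualForm (g : E → E →L[ℝ] E →L[ℝ] ℝ) (u : E → E) (x : E) : E →L[ℝ] ℝ := g x (u x)

/-- The acceleration form of the unit vector field `u`. -/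
noncomputable def accelerationForm (g : E → E →L[ℝ] E →L[ℝ] ℝ) (u : E → E) (x : E) : E →L[ℝ] ℝ :=
  fderiv ℝ (dualForm g u) x (u x) - (fderiv ℝ (dualForm g u) x).flip (u x)

/-- The vorticity form of the unit vector field `u`. -/
noncomputable def vorticityForm (g : E → E →L[ℝ] E →L[ℝ] ℝ) (u : E → E) (x : E) :
    E →L[ℝ] E →L[ℝ] ℝ :=
  (1 / 2 : ℝ) • (fderiv ℝ (dualForm g u) x - (fderiv ℝ (dualForm g u) x).flip
    - (dualForm g u x).smulRight (accelerationForm g u x)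
    + (accelerationForm g u x).smulRight (dualForm g u x))

theorem vorticityForm_apply (g : E → E →L[ℝ] E →L[ℝ] ℝ) (u : E → E) (x a b : E) :
    vorticityForm g u x a b = (1 / 2) * (fderiv ℝ (dualForm g u) x a b
      - fderiv ℝ (dualForm g u) x b a - dualForm g u x a * accelerationForm g u x b
      + accelerationForm g u x a * dualForm g u x b) := by
  simp [vorticityForm]
  ring

theorem accelerationForm_apply (g : E → E →L[ℝ] E →L[ℝ] ℝ) (u : E → E) (x b : E) :
    accelerationForm g u x b = fderiv ℝ (dualForm g u) x (u x) b
      - fderiv ℝ (dualForm g u) x b (u x) := by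
  simp [accelerationForm]

/-- The vector fields and maps occurring in the coordinate expression of a rigid flow. -/
structure IsCoordinateRigidFlow (p : E) (g : E → E →L[ℝ] E →L[ℝ] ℝ) (u : E → E) (f : E → E')
    (h : E' → E' →L[ℝ] E' →L[ℝ] ℝ) : Prop where
  smooth_u : ContDiffAt ℝ ∞ u p
  smooth_f : ContDiffAt ℝ ∞ f p
  smooth_h : ContDiffAt ℝ ∞ h (f p)
  unit : ∀ᶠ x in 𝓝 p, g x (u x) (u x) = 1
  tangent_fibre : ∀ᶠ x in 𝓝 p, fderiv ℝ f x (u x) = 0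
  isometric : ∀ᶠ x in 𝓝 p, ∀ v w, h (f x) (fderiv ℝ f x v) (fderiv ℝ f x w) =
    g x v w - g x (u x) v * g x (u x) w

/-- The Riemannian metric in coordinates. -/
structure IsCoordinateMetric (p : E) (g : E → E →L[ℝ] E →L[ℝ] ℝ) : Prop where
  smooth : ContDiffAt ℝ ∞ g p
  symm : ∀ᶠ x in 𝓝 p, ∀ a b, g x a b = g x b a
  pos : ∀ᶠ x in 𝓝 p, ∀ a, a ≠ 0 → 0 < g x a a

namespace IsCoordinateRigidFlow

open Controlled

variable {p : E} {g : E → E →L[ℝ] E →L[ℝ] ℝ} {u : E → E} {f : E → E'}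
    {h : E' → E' →L[ℝ] E' →L[ℝ] ℝ}

theorem smooth_dualForm (hg : IsCoordinateMetric p g) (hu : ContDiffAt ℝ ∞ u p) :
    ContDiffAt ℝ ∞ (dualForm g u) p := hg.smooth.clm_apply hu

theorem smooth_accelerationForm (hg : IsCoordinateMetric p g) (hu : ContDiffAt ℝ ∞ u p) :
    ContDiffAt ℝ ∞ (accelerationForm g u) p := by
  have h1 := fderiv_smooth (smooth_dualForm hg hu)
  have h2 : ContDiffAt ℝ ∞ (fun x => (fderiv ℝ (dualForm g u) x).flip) p :=
    (ContinuousLinearMap.flipₗᵢ ℝ E E ℝ).contDiff.contDiffAt.comp p h1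
  exact (h1.clm_apply hu).sub (h2.clm_apply hu)

theorem smooth_vorticityForm (hg : IsCoordinateMetric p g) (hu : ContDiffAt ℝ ∞ u p) :
    ContDiffAt ℝ ∞ (vorticityForm g u) p := by
  have h0 := smooth_dualForm hg hu
  have h1 := fderiv_smooth (smooth_dualForm hg hu)
  have h2 : ContDiffAt ℝ ∞ (fun x => (fderiv ℝ (dualForm g u) x).flip) p :=
    (ContinuousLinearMap.flipₗᵢ ℝ E E ℝ).contDiff.contDiffAt.comp p h1
  have h3 := smooth_accelerationForm hg hu
  exact (((h1.sub h2).sub (h0.smulRight h3)).add (h3.smulRight h0)).const_smul (1 / 2 : ℝ)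

theorem fderiv_dualForm (hg : IsCoordinateMetric p g) (hu : ContDiffAt ℝ ∞ u p) :
    ∀ᶠ x in 𝓝 p, ∀ a b, fderiv ℝ (dualForm g u) x a b =
      fderiv ℝ g x a (u x) b + g x (fderiv ℝ u x a) b := by
  filter_upwards [eventually_differentiableAt hg.smooth, eventually_differentiableAt hu]
    with x dg du a b
  have : HasFDerivAt (dualForm g u) _ x := dg.hasFDerivAt.clm_apply du.hasFDerivAt
  rw [this.fderiv]
  simp [add_comm]

theorem fderiv_symm (hg : IsCoordinateMetric p g) :
    ∀ᶠ x in 𝓝 p, ∀ c a b, fderiv ℝ g x c a b = fderiv ℝ g x c b a := by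
  filter_upwards [eventually_differentiableAt hg.smooth, hg.symm.eventually_nhds] with x dg hx c a b
  have e : g =ᶠ[𝓝 x] fun y => (g y).flip := by
    filter_upwards [hx] with y hy
    ext a b
    simp [hy a b]
  have d : HasFDerivAt (fun y => (g y).flip) _ x :=
    (ContinuousLinearMap.flipₗᵢ ℝ E E ℝ).toContinuousLinearEquiv.toContinuousLinearMap.hasFDerivAt.comp
      x dg.hasFDerivAt
  have := congrArg (fun L => L c a b) (e.fderiv_eq.trans d.fderiv)
  simpa using this

/-- The derivative of the metric along the flow. -/
theorem fderiv_metric (hu : IsCoordinateRigidFlow p g u f h) (hg : IsCoordinateMetric p g) :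
    ∀ᶠ x in 𝓝 p, ∀ v w, fderiv ℝ g x (u x) v w
      - fderiv ℝ (dualForm g u) x (u x) v * dualForm g u x w
      - dualForm g u x v * fderiv ℝ (dualForm g u) x (u x) w
      = -(g x (fderiv ℝ u x v) w - dualForm g u x (fderiv ℝ u x v) * dualForm g u x w)
        - (g x v (fderiv ℝ u x w) - dualForm g u x v * dualForm g u x (fderiv ℝ u x w)) := by
  have hf2 : ContDiffAt ℝ 2 f p := hu.smooth_f.of_le (by norm_cast)
  have dh : ∀ᶠ x in 𝓝 p, DifferentiableAt ℝ h (f x) :=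
    hu.smooth_f.continuousAt.eventually (eventually_differentiableAt hu.smooth_h)
  filter_upwards [eventually_differentiableAt hg.smooth, eventually_differentiableAt hu.smooth_u,
    eventually_differentiableAt hu.smooth_f, eventually_differentiableAt (fderiv_smooth hu.smooth_f),
    eventually_differentiableAt (smooth_dualForm hg hu.smooth_u), dh,
    hu.isometric.eventually_nhds, hu.tangent_fibre.eventually_nhds, hf2.eventually (by simp)]
    with x dg du df ddf dψ dh hi ht hf2 v w
  have hs : IsSymmSndFDerivAt ℝ f x := hf2.isSymmSndFDerivAt (by simp)
  -- Differentiating `df(u) = 0` and using symmetry of the second derivative removes all second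
  -- derivatives of `f`. Since also `df(u) = 0` kills the derivative of `h`, differentiating the
  -- isometry condition along `u` says that the horizontal metric is invariant under the flow.
  have e1 : ∀ v, fderiv ℝ (fderiv ℝ f) x (u x) v = -fderiv ℝ f x (fderiv ℝ u x v) := by
    intro v
    have e : (fun y => fderiv ℝ f y (u y)) =ᶠ[𝓝 x] fun _ => 0 := ht
    have := congrArg (fun L => L v)
      ((ddf.hasFDerivAt.clm_apply du.hasFDerivAt).fderiv.symm.trans e.fderiv_eq)
    simp at this
    rw [hs, eq_neg_iff_add_eq_zero, add_comm, this]
  have e2 : (fun y => h (f y) (fderiv ℝ f y v) (fderiv ℝ f y w)) =ᶠ[𝓝 x]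
      fun y => g y v w - dualForm g u y v * dualForm g u y w := by
    filter_upwards [hi] with y hy using hy v w
  have d1 := ((dh.hasFDerivAt.comp x df.hasFDerivAt).clm_apply
    (ddf.hasFDerivAt.clm_apply (hasFDerivAt_const v x))).clm_apply
    (ddf.hasFDerivAt.clm_apply (hasFDerivAt_const w x))
  have d2 := ((dg.hasFDerivAt.clm_apply (hasFDerivAt_const v x)).clm_apply
    (hasFDerivAt_const w x)).sub ((dψ.hasFDerivAt.clm_apply (hasFDerivAt_const v x)).mul
      (dψ.hasFDerivAt.clm_apply (hasFDerivAt_const w x)))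
  have e3 := congrArg (fun L => L (u x)) (d1.fderiv.symm.trans (e2.fderiv_eq.trans d2.fderiv))
  have ht := ht.self_of_nhds
  have hi := hi.self_of_nhds
  simp [ht, e1, hi] at e3
  simp only [dualForm] at e3 ⊢
  linear_combination -e3

theorem isInvertible (hg : IsCoordinateMetric p g) [FiniteDimensional ℝ E] :
    ∀ᶠ x in 𝓝 p, (g x).IsInvertible := by
  filter_upwards [hg.pos] with x hx
  have hinj : Function.Injective (g x : E →ₗ[ℝ] (E →L[ℝ] ℝ)) := by
    rw [← LinearMap.ker_eq_bot, LinearMap.ker_eq_bot']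
    intro a ha
    by_contra h0
    have := hx a h0
    have ha : g x a = 0 := ha
    simp [ha] at this
  have hdim : Module.finrank ℝ E = Module.finrank ℝ (E →L[ℝ] ℝ) := by
    rw [← (LinearMap.toContinuousLinearMap (𝕜 := ℝ) (E := E) (F' := ℝ)).finrank_eq]
    exact (Subspace.dual_finrank_eq (K := ℝ) (V := E)).symm
  exact ⟨(LinearEquiv.ofInjectiveOfFinrankEq _ hinj hdim).toContinuousLinearEquiv, by
    ext a b; rfl⟩

/-- The derivative of the dual form of a rigid flow. -/
theorem fderiv_dualForm_eq (hu : IsCoordinateRigidFlow p g u f h) (hg : IsCoordinateMetric p g) :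
    ∀ᶠ x in 𝓝 p, ∀ a b, fderiv ℝ (dualForm g u) x a b = christoffel g x (u x) a b
      + vorticityForm g u x a b + dualForm g u x a * accelerationForm g u x b := by
  filter_upwards [hu.fderiv_metric hg, fderiv_dualForm hg hu.smooth_u, fderiv_symm hg, hg.symm,
    hu.unit.eventually_nhds, eventually_differentiableAt hu.smooth_u,
    eventually_differentiableAt (smooth_dualForm hg hu.smooth_u)]
    with x h1 h2 h3 h4 h5 du dψ a b
  have h6 : ∀ v, fderiv ℝ (dualForm g u) x v (u x) = -dualForm g u x (fderiv ℝ u x v) := by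
    intro v
    have e : (fun y => dualForm g u y (u y)) =ᶠ[𝓝 x] fun _ => 1 := h5
    have := congrArg (fun L => L v)
      ((dψ.hasFDerivAt.clm_apply du.hasFDerivAt).fderiv.symm.trans e.fderiv_eq)
    simp at this
    linarith
  rw [vorticityForm_apply, christoffel_apply, accelerationForm_apply, accelerationForm_apply,
    h6, h6]
  have e1 := h1 a b
  have e2 := h2 a b
  have e3 := h2 b a
  have e4 := h4 a (fderiv ℝ u x b)
  -- The antisymmetric part holds by the definition of `vorticityForm`. What remains is symmetric in
  -- `a` and `b`, the vanishing of the shear, and comes from `e1`.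
  linear_combination (1 / 2) * e1 + (1 / 2) * e2 + (1 / 2) * e3 - (1 / 2) * e4

/-- A rigid flow satisfies the structure equations. -/
theorem isRigidTriple [FiniteDimensional ℝ E] (hu : IsCoordinateRigidFlow p g u f h)
    (hg : IsCoordinateMetric p g) :
    ContDiffAt ℝ ∞ (fun x => (g x).inverse) p ∧ (∀ᶠ x in 𝓝 p, (g x).inverse (dualForm g u x) = u x)
    ∧ IsRigidTriple p (fun x => (g x).inverse) (fun x => (christoffel g x).comp (g x).inverse)
      (dualForm g u) (vorticityForm g u) (accelerationForm g u) := by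
  have hinv := isInvertible hg
  -- The inverse metric recovers the velocity from its dual form, so velocity and Christoffel term
  -- are linear in that form, with coefficients that depend on the metric only.
  have hs : ContDiffAt ℝ ∞ (fun x => (g x).inverse) p :=
    (hinv.self_of_nhds.contDiffAt_map_inverse).comp p hg.smooth
  have hsu : ∀ᶠ x in 𝓝 p, (g x).inverse (dualForm g u x) = u x := by
    filter_upwards [hinv] with x hx
    obtain ⟨e, he⟩ := hx
    simp [dualForm, ← he]
  refine ⟨hs, hsu, ?_⟩
  have hψ := smooth_dualForm hg hu.smooth_u
  have hκ := smooth_accelerationForm hg hu.smooth_u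
  have hθ := smooth_vorticityForm hg hu.smooth_u
  have hψu : ∀ᶠ x in 𝓝 p, dualForm g u x (u x) = 1 := hu.unit
  have hκu : ∀ x, accelerationForm g u x (u x) = 0 := fun x => by
    simp [accelerationForm_apply]
  refine ⟨hu.smooth_u.congr_of_eventuallyEq hsu, hψ,
    ((contDiffAt_christoffel hg.smooth).clm_comp hs).clm_apply hψ, hθ, hκ, ?_, ?_, ?_, ?_, ?_, ?_⟩
  · filter_upwards [fderiv_symm hg] with x h3 a b
    simp only [ContinuousLinearMap.comp_apply, christoffel_apply]
    rw [h3 _ a b]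
    ring
  · filter_upwards [hsu, hψu] with x h1 h2
    rw [h1, h2]
  · filter_upwards [hsu] with x h1
    rw [h1, hκu]
  · filter_upwards [hsu, hψu] with x h1 h2 b
    rw [h1, vorticityForm_apply, hκu, h2, accelerationForm_apply]
    ring
  · refine Filter.Eventually.of_forall fun x a b => ?_
    rw [vorticityForm_apply, vorticityForm_apply]
    ring
  · filter_upwards [hsu, hu.fderiv_dualForm_eq hg] with x h1 h2 a b
    rw [h2, ContinuousLinearMap.comp_apply, h1]

/-- Two rigid flows with the same first derivatives at a point where they have vorticity agree near
that point. -/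
theorem eventually_eq [FiniteDimensional ℝ E] {E'' : Type*} [NormedAddCommGroup E'']
    [NormedSpace ℝ E''] {u' : E → E} {f' : E → E''} {h' : E'' → E'' →L[ℝ] E'' →L[ℝ] ℝ}
    (hu : IsCoordinateRigidFlow p g u f h) (hu' : IsCoordinateRigidFlow p g u' f' h')
    (hg : IsCoordinateMetric p g) (h0 : u p = u' p) (h1 : fderiv ℝ u p = fderiv ℝ u' p)
    (hθ : ∃ a b, vorticityForm g u p a b ≠ 0) : ∀ᶠ x in 𝓝 p, u x = u' x := by
  obtain ⟨hs, hsu, ht⟩ := hu.isRigidTriple hg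
  obtain ⟨-, hsu', ht'⟩ := hu'.isRigidTriple hg
  have e0 : dualForm g u p = dualForm g u' p := by simp [dualForm, h0]
  have e1 : fderiv ℝ (dualForm g u) p = fderiv ℝ (dualForm g u') p := by
    ext a b
    rw [(fderiv_dualForm hg hu.smooth_u).self_of_nhds,
      (fderiv_dualForm hg hu'.smooth_u).self_of_nhds, h0, h1]
  have e2 : accelerationForm g u p = accelerationForm g u' p := by
    simp [accelerationForm, e1, h0]
  have e3 : vorticityForm g u p = vorticityForm g u' p := by
    simp [vorticityForm, e0, e1, e2]
  filter_upwards [ht.eventually_eq ht' hs ((contDiffAt_christoffel hg.smooth).clm_comp hs) e0 e3 e2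
    hθ, hsu, hsu'] with x k1 k2 k3
  rw [← k2, k1, k3]

end IsCoordinateRigidFlow
end Coordinates

/-! ### Initial data on a transversal hypersurface -/

section Hypersurface

variable {E E' E'' : Type*} [NormedAddCommGroup E] [NormedSpace ℝ E]
  [NormedAddCommGroup E'] [NormedSpace ℝ E'] [NormedAddCommGroup E''] [NormedSpace ℝ E'']

/-- A function vanishing on a regular level set has a differential proportional to that of the
equation of the level set. -/
theorem exists_fderiv_eq_smul_of_eq_zero [CompleteSpace E] {f φ : E → ℝ} {x : E}
    (hf : ContDiffAt ℝ 1 f x) (hφ : ContDiffAt ℝ 1 φ x) (h0 : φ x = 0)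
    (h : ∀ᶠ y in 𝓝 x, φ y = 0 → f y = 0) (hne : fderiv ℝ φ x ≠ 0) :
    ∃ c : ℝ, fderiv ℝ f x = c • fderiv ℝ φ x := by
  have hx : f x = 0 := h.self_of_nhds h0
  -- A function vanishing on the level set has a constrained extremum there, so Lagrange multipliers
  -- apply. The multiplier of `f` is nonzero because the differential of `φ` is.
  have hext : IsLocalExtrOn f {y | φ y = φ x} x := by
    left
    refine eventually_nhdsWithin_iff.2 ?_
    filter_upwards [h] with y hy hy'
    rw [hx, hy (hy'.trans h0)]
  obtain ⟨a, b, hab, h1⟩ := hext.exists_multipliers_of_hasStrictFDerivAt_1d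
    (hφ.hasStrictFDerivAt one_ne_zero) (hf.hasStrictFDerivAt one_ne_zero)
  have hb : b ≠ 0 := by
    rintro rfl
    have ha : a ≠ 0 := by rintro rfl; exact hab rfl
    simp [ha, hne] at h1
  refine ⟨-(a / b), ?_⟩
  have : fderiv ℝ f x = b⁻¹ • (b • fderiv ℝ f x) := by rw [inv_smul_smul₀ hb]
  rw [this, eq_neg_of_add_eq_zero_right h1, div_eq_inv_mul, smul_neg, smul_smul, neg_smul]

namespace IsCoordinateRigidFlow

open Controlled

variable [FiniteDimensional ℝ E] {p : E} {g : E → E →L[ℝ] E →L[ℝ] ℝ} {u u' : E → E}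
    {f : E → E'} {f' : E → E''} {h : E' → E' →L[ℝ] E' →L[ℝ] ℝ} {h' : E'' → E'' →L[ℝ] E'' →L[ℝ] ℝ}

/-- If two rigid flows with the same vorticity on a transversal hypersurface have different
acceleration at a point of it, then the hypersurface is orthogonal to the flow there. -/
theorem orthogonal_of_accelerationForm_ne (hu : IsCoordinateRigidFlow p g u f h)
    (hu' : IsCoordinateRigidFlow p g u' f' h') (hg : IsCoordinateMetric p g) {φ : E → ℝ}
    (hφ : ContDiffAt ℝ ∞ φ p)
    (heq : ∀ᶠ x in 𝓝 p, φ x = 0 → u x = u' x ∧ vorticityForm g u x = vorticityForm g u' x)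
    (htrans : fderiv ℝ φ p (u p) ≠ 0) : ∀ᶠ x in 𝓝 p, φ x = 0 →
      ∀ b, accelerationForm g u x b ≠ accelerationForm g u' x b →
      ∀ a, fderiv ℝ φ x a = fderiv ℝ φ x (u x) * dualForm g u x a := by
  have hψ := smooth_dualForm hg hu.smooth_u
  have hψ' := smooth_dualForm hg hu'.smooth_u
  have hψ1 : ContDiffAt ℝ 1 (dualForm g u) p := hψ.of_le (by simp)
  have hψ1' : ContDiffAt ℝ 1 (dualForm g u') p := hψ'.of_le (by simp)
  have hφ1 : ContDiffAt ℝ 1 φ p := hφ.of_le (by simp)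
  have ht : ∀ᶠ x in 𝓝 p, fderiv ℝ φ x (u x) ≠ 0 :=
    ((fderiv_smooth hφ).clm_apply hu.smooth_u).continuousAt.eventually_ne htrans
  filter_upwards [heq.eventually_nhds, ht, hu.unit, hu.fderiv_dualForm_eq hg,
    hu'.fderiv_dualForm_eq hg, hψ1.eventually (by simp), hψ1'.eventually (by simp),
    hφ1.eventually (by simp)] with x hx ht hunit d1 d2 c1 c2 c3 h0 b hb a
  have e0 := hx.self_of_nhds h0
  have eψ : dualForm g u' x = dualForm g u x := by simp [dualForm, e0.1]
  have c4 : ContDiffAt ℝ 1 (fun y => dualForm g u y b) x := c1.clm_apply contDiffAt_const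
  have c5 : ContDiffAt ℝ 1 (fun y => dualForm g u' y b) x := c2.clm_apply contDiffAt_const
  obtain ⟨c, hc⟩ := exists_fderiv_eq_smul_of_eq_zero (c4.sub c5) c3 h0 (by
    filter_upwards [hx] with y hy hy0
    simp [dualForm, (hy hy0).1]) (by rintro h; simp [h] at ht)
  -- By the structure equations the differentials of the two dual forms differ only by `ψ ⊗ (κ -
  -- κ')`. The components of the dual forms agree on the hypersurface, so this is also a multiple of
  -- the differential of `φ`.
  have hd : ∀ v, dualForm g u x v * (accelerationForm g u x b - accelerationForm g u' x b) =
      c * fderiv ℝ φ x v := by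
    intro v
    have := congrArg (fun L => L v) hc
    have d : HasFDerivAt (fun y => dualForm g u y b - dualForm g u' y b) _ x :=
      ((c1.differentiableAt one_ne_zero).hasFDerivAt.clm_apply (hasFDerivAt_const b x)).sub
      ((c2.differentiableAt one_ne_zero).hasFDerivAt.clm_apply (hasFDerivAt_const b x))
    rw [d.fderiv] at this
    simp [d1, d2, ← e0.1, ← e0.2, eψ] at this
    linarith
  have hunit : dualForm g u x (u x) = 1 := hunit
  have k1 := hd (u x)
  rw [hunit] at k1
  have hc0 : c ≠ 0 := by
    rintro rfl
    simp [sub_eq_zero, hb] at k1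
  have k2 := hd a
  apply mul_left_cancel₀ hc0
  linear_combination -k2 + dualForm g u x a * k1

/-- Two rigid flows with the same velocity and vorticity on a transversal hypersurface have the same
first derivatives at the points of the hypersurface where they have vorticity. -/
theorem fderiv_eq_of_hypersurface (hu : IsCoordinateRigidFlow p g u f h)
    (hu' : IsCoordinateRigidFlow p g u' f' h') (hg : IsCoordinateMetric p g) {φ : E → ℝ}
    (hφ : ContDiffAt ℝ ∞ φ p) (h0 : φ p = 0)
    (heq : ∀ᶠ x in 𝓝 p, φ x = 0 → u x = u' x ∧ vorticityForm g u x = vorticityForm g u' x)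
    (htrans : fderiv ℝ φ p (u p) ≠ 0) (hθ : ∃ a b, vorticityForm g u p a b ≠ 0) :
    fderiv ℝ u p = fderiv ℝ u' p := by
  have hψ := smooth_dualForm hg hu.smooth_u
  have d1 := (hu.fderiv_dualForm_eq hg).self_of_nhds
  have d2 := (hu'.fderiv_dualForm_eq hg).self_of_nhds
  have e0 := heq.self_of_nhds h0
  have eψ : dualForm g u' p = dualForm g u p := by simp [dualForm, e0.1]
  -- If the accelerations differ at `p`, they differ nearby, so the differential of `φ` is
  -- proportional to the dual form along the hypersurface near `p`. Differentiating this relation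
  -- tangentially gives the Frobenius argument against vorticity.
  have hκ : accelerationForm g u p = accelerationForm g u' p := by
    by_contra hne
    obtain ⟨b, hb⟩ : ∃ b, accelerationForm g u p b ≠ accelerationForm g u' p b := by
      by_contra! hcon
      exact hne (ContinuousLinearMap.ext hcon)
    have hb' : ∀ᶠ x in 𝓝 p, accelerationForm g u x b ≠ accelerationForm g u' x b := by
      have c1 := (smooth_accelerationForm hg hu.smooth_u).clm_apply (contDiffAt_const (c := b))
      have c2 := (smooth_accelerationForm hg hu'.smooth_u).clm_apply (contDiffAt_const (c := b))
      exact (c1.continuousAt.ne_iff_eventually_ne c2.continuousAt).1 hb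
    have hdφ := fderiv_smooth hφ
    have hφ2 : ContDiffAt ℝ 2 φ p := hφ.of_le (by norm_cast)
    have hs : IsSymmSndFDerivAt ℝ φ p := hφ2.isSymmSndFDerivAt (by simp)
    have hφu := hdφ.clm_apply hu.smooth_u
    have horth := hu.orthogonal_of_accelerationForm_ne hu' hg hφ heq htrans
    -- the second derivative of the equation on horizontal vectors
    have key : ∀ c a, dualForm g u p c = 0 → dualForm g u p a = 0 →
        fderiv ℝ (fderiv ℝ φ) p c a = fderiv ℝ φ p (u p) * fderiv ℝ (dualForm g u) p c a := by
      intro c a hc ha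
      have hq : ContDiffAt ℝ ∞
          (fun x => fderiv ℝ φ x a - fderiv ℝ φ x (u x) * dualForm g u x a) p :=
        (hdφ.clm_apply contDiffAt_const).sub (hφu.mul (hψ.clm_apply contDiffAt_const))
      obtain ⟨m, hm⟩ := exists_fderiv_eq_smul_of_eq_zero (hq.of_le (by simp))
        (hφ.of_le (by simp)) h0 (by
          filter_upwards [horth, hb'] with x k1 k2 k3
          rw [sub_eq_zero]
          exact k1 k3 b k2 a) (by rintro h; simp [h] at htrans)
      have d : HasFDerivAt (fun x => fderiv ℝ φ x a - fderiv ℝ φ x (u x) * dualForm g u x a) _ p :=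
        ((hdφ.differentiableAt (by simp)).hasFDerivAt.clm_apply (hasFDerivAt_const a p)).sub
        ((hφu.differentiableAt (by simp)).hasFDerivAt.mul
          ((hψ.differentiableAt (by simp)).hasFDerivAt.clm_apply (hasFDerivAt_const a p)))
      have hc' : fderiv ℝ φ p c = 0 := by
        rw [horth.self_of_nhds h0 b hb c, hc, mul_zero]
      have := congrArg (fun L => L c) (d.fderiv.symm.trans hm)
      simp [ha, hc'] at this
      linarith
    -- Symmetry of the second derivative of `φ` makes the derivative of the dual form symmetric on
    -- horizontal vectors.
    have hθ0 : ∀ c a, dualForm g u p c = 0 → dualForm g u p a = 0 →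
        vorticityForm g u p c a = 0 := by
      intro c a hc ha
      have k := key c a hc ha
      rw [hs c a, key a c ha hc] at k
      have := mul_left_cancel₀ htrans k
      rw [vorticityForm_apply, hc, ha, this]
      ring
    obtain ⟨a, b, hab⟩ := hθ
    apply hab
    obtain ⟨-, hsu, ht⟩ := hu.isRigidTriple hg
    have hsu := hsu.self_of_nhds
    have e1 := ht.θ_horizontalPart.self_of_nhds
    have e2 := ht.θ_antisymm.self_of_nhds
    have e3 := ht.ψ_horizontalPart.self_of_nhds
    rw [← e1, e2, ← e1, e2, hθ0 _ _ (e3 _) (e3 _)]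
    simp
  have hψ1 : ∀ a b, fderiv ℝ (dualForm g u) p a b = fderiv ℝ (dualForm g u') p a b := by
    intro a b
    rw [d1, d2, e0.1, e0.2, eψ, hκ]
  ext1 a
  have k1 := (fderiv_dualForm hg hu.smooth_u).self_of_nhds a
  have k2 := (fderiv_dualForm hg hu'.smooth_u).self_of_nhds a
  have hw : ∀ w, g p (fderiv ℝ u p a - fderiv ℝ u' p a) w = 0 := by
    intro w
    have k3 := hψ1 a w
    rw [k1, k2, e0.1] at k3
    rw [map_sub, _root_.sub_apply]
    linarith
  by_contra hne
  exact (hg.pos.self_of_nhds _ (sub_ne_zero.2 hne)).ne' (hw _)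

end IsCoordinateRigidFlow
end Hypersurface

/-! ### Passage to a chart -/

section Chart

variable {n : ℕ} {M : Type*} [TopologicalSpace M]
    [ChartedSpace (EuclideanSpace ℝ (Fin (n + 1))) M]

/-- The differential of the inverse of the chart at `p`. -/
noncomputable def chartDeriv (p : M) (x : EuclideanSpace ℝ (Fin (n + 1))) :
    EuclideanSpace ℝ (Fin (n + 1)) →L[ℝ]
      TangentSpace (𝓡 (n + 1)) ((extChartAt (𝓡 (n + 1)) p).symm x) :=
  mfderiv 𝓘(ℝ, EuclideanSpace ℝ (Fin (n + 1))) (𝓡 (n + 1)) (extChartAt (𝓡 (n + 1)) p).symm x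

/-- The expression of a vector field in the chart at `p`. -/
noncomputable def chartField (p : M) (Z : ∀ x : M, TangentSpace (𝓡 (n + 1)) x)
    (x : EuclideanSpace ℝ (Fin (n + 1))) : EuclideanSpace ℝ (Fin (n + 1)) :=
  mpullback 𝓘(ℝ, EuclideanSpace ℝ (Fin (n + 1))) (𝓡 (n + 1)) (extChartAt (𝓡 (n + 1)) p).symm Z x

/-- The expression of the metric in the chart at `p`. -/
noncomputable def chartMetric [RiemannianBundle (fun x : M => TangentSpace (𝓡 (n + 1)) x)]
    (p : M) (x : EuclideanSpace ℝ (Fin (n + 1))) :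
    EuclideanSpace ℝ (Fin (n + 1)) →L[ℝ] EuclideanSpace ℝ (Fin (n + 1)) →L[ℝ] ℝ :=
  (innerSL ℝ).bilinearComp (chartDeriv p x) (chartDeriv p x)

theorem chartMetric_apply [RiemannianBundle (fun x : M => TangentSpace (𝓡 (n + 1)) x)]
    (p : M) (x a b : EuclideanSpace ℝ (Fin (n + 1))) :
    chartMetric p x a b = inner ℝ (chartDeriv p x a) (chartDeriv p x b) := rfl

variable [IsManifold (𝓡 (n + 1)) ∞ M]

theorem contMDiffAt_chart_symm {p : M} {x : EuclideanSpace ℝ (Fin (n + 1))}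
    (hx : x ∈ (extChartAt (𝓡 (n + 1)) p).target) :
    ContMDiffAt 𝓘(ℝ, EuclideanSpace ℝ (Fin (n + 1))) (𝓡 (n + 1)) ∞
      (extChartAt (𝓡 (n + 1)) p).symm x :=
  (contMDiffOn_extChartAt_symm p).contMDiffAt ((isOpen_extChartAt_target p).mem_nhds hx)

theorem isInvertible_chartDeriv {p : M} {x : EuclideanSpace ℝ (Fin (n + 1))}
    (hx : x ∈ (extChartAt (𝓡 (n + 1)) p).target) : (chartDeriv p x).IsInvertible := by
  have := isInvertible_mfderivWithin_extChartAt_symm (I := 𝓡 (n + 1)) hx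
  rwa [modelWithCornersSelf_coe, Set.range_id, mfderivWithin_univ] at this

theorem chartDeriv_chartField {p : M} {x : EuclideanSpace ℝ (Fin (n + 1))}
    (hx : x ∈ (extChartAt (𝓡 (n + 1)) p).target) (Z : ∀ x : M, TangentSpace (𝓡 (n + 1)) x) :
    chartDeriv p x (chartField p Z x) = Z ((extChartAt (𝓡 (n + 1)) p).symm x) := by
  exact (isInvertible_chartDeriv hx).self_apply_inverse _

theorem contDiffAt_chartField {p : M} {x : EuclideanSpace ℝ (Fin (n + 1))}
    (hx : x ∈ (extChartAt (𝓡 (n + 1)) p).target) {Z : ∀ x : M, TangentSpace (𝓡 (n + 1)) x}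
    (hZ : ContMDiffAt (𝓡 (n + 1)) (𝓡 (n + 1)).tangent ∞
      (fun x => (⟨x, Z x⟩ : TangentBundle (𝓡 (n + 1)) M)) ((extChartAt (𝓡 (n + 1)) p).symm x)) :
    ContDiffAt ℝ ∞ (chartField p Z) x := by
  have := ContMDiffAt.mpullback_vectorField_preimage (n := ∞) hZ (contMDiffAt_chart_symm hx)
    (isInvertible_chartDeriv hx) (by simp)
  rw [contMDiffAt_vectorSpace_iff_contDiffAt] at this
  exact this

theorem contDiffAt_chartMetric [RiemannianBundle (fun x : M => TangentSpace (𝓡 (n + 1)) x)]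
    [IsContMDiffRiemannianBundle (𝓡 (n + 1)) ∞ (EuclideanSpace ℝ (Fin (n + 1)))
      (fun x : M => TangentSpace (𝓡 (n + 1)) x)] {p : M} {x : EuclideanSpace ℝ (Fin (n + 1))}
    (hx : x ∈ (extChartAt (𝓡 (n + 1)) p).target) :
    ContDiffAt ℝ ∞ (chartMetric p) x := by
  have h1 : ContMDiffOn 𝓘(ℝ, EuclideanSpace ℝ (Fin (n + 1))).tangent (𝓡 (n + 1)).tangent ∞
      (tangentMapWithin 𝓘(ℝ, EuclideanSpace ℝ (Fin (n + 1))) (𝓡 (n + 1))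
        (extChartAt (𝓡 (n + 1)) p).symm (extChartAt (𝓡 (n + 1)) p).target)
      (TotalSpace.proj ⁻¹' (extChartAt (𝓡 (n + 1)) p).target) :=
    (contMDiffOn_extChartAt_symm (n := ∞) p).contMDiffOn_tangentMapWithin (by simp)
      (isOpen_extChartAt_target p).uniqueMDiffOn
  have h2 : ∀ a : EuclideanSpace ℝ (Fin (n + 1)), ContMDiffAt
      𝓘(ℝ, EuclideanSpace ℝ (Fin (n + 1))) (𝓡 (n + 1)).tangent ∞
      (fun y => (⟨(extChartAt (𝓡 (n + 1)) p).symm y, chartDeriv p y a⟩ :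
        TangentBundle (𝓡 (n + 1)) M)) x := by
    intro a
    have h3 : ContMDiffAt 𝓘(ℝ, EuclideanSpace ℝ (Fin (n + 1)))
        𝓘(ℝ, EuclideanSpace ℝ (Fin (n + 1))).tangent ∞
        (fun y => (⟨y, a⟩ : TangentBundle 𝓘(ℝ, EuclideanSpace ℝ (Fin (n + 1)))
          (EuclideanSpace ℝ (Fin (n + 1))))) x :=
      contMDiffAt_vectorSpace_iff_contDiffAt.2 (contDiffAt_const (c := a))
    have h4 := (h1.contMDiffAt (x := ⟨x, a⟩) (((isOpen_extChartAt_target p).preimage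
      (FiberBundle.continuous_proj _ _)).mem_nhds hx)).comp x h3
    refine h4.congr_of_eventuallyEq ?_
    filter_upwards [(isOpen_extChartAt_target p).mem_nhds hx] with y hy
    simp only [Function.comp_apply, tangentMapWithin]
    rw [mfderivWithin_of_isOpen (isOpen_extChartAt_target p) hy]
    rfl
  -- `Controlled` serves only to reduce smoothness of a field of bilinear forms to its values on
  -- constant vectors; the defect is a dummy.
  refine (Controlled.clm_of_apply (δ := fun _ => (0 : ℝ)) fun a => Controlled.clm_of_apply fun b =>
    Controlled.refl ?_).left
  exact ((h2 a).inner_bundle (h2 b)).contDiffAt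

/-- The differential of a function in the chart at `p`. -/
theorem mvfderiv_chartDeriv {F : Type*} [NormedAddCommGroup F] [NormedSpace ℝ F] {p : M}
    {x : EuclideanSpace ℝ (Fin (n + 1))}
    (hx : x ∈ (extChartAt (𝓡 (n + 1)) p).target) {f : M → F}
    (hf : MDifferentiableAt (𝓡 (n + 1)) 𝓘(ℝ, F) f ((extChartAt (𝓡 (n + 1)) p).symm x))
    (a : EuclideanSpace ℝ (Fin (n + 1))) :
    mvfderiv (𝓡 (n + 1)) f ((extChartAt (𝓡 (n + 1)) p).symm x) (chartDeriv p x a) =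
      fderiv ℝ (f ∘ (extChartAt (𝓡 (n + 1)) p).symm) x a := by
  have h := mfderiv_comp_apply x hf ((contMDiffAt_chart_symm hx).mdifferentiableAt (by simp)) a
  rw [mfderiv_eq_fderiv] at h
  exact h.symm

theorem mlieBracket_chart {p : M} {x : EuclideanSpace ℝ (Fin (n + 1))}
    (hx : x ∈ (extChartAt (𝓡 (n + 1)) p).target) {V W : ∀ x : M, TangentSpace (𝓡 (n + 1)) x}
    (hV : MDifferentiableAt (𝓡 (n + 1)) (𝓡 (n + 1)).tangent
      (fun x => (⟨x, V x⟩ : TangentBundle (𝓡 (n + 1)) M)) ((extChartAt (𝓡 (n + 1)) p).symm x))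
    (hW : MDifferentiableAt (𝓡 (n + 1)) (𝓡 (n + 1)).tangent
      (fun x => (⟨x, W x⟩ : TangentBundle (𝓡 (n + 1)) M)) ((extChartAt (𝓡 (n + 1)) p).symm x)) :
    mlieBracket (𝓡 (n + 1)) V W ((extChartAt (𝓡 (n + 1)) p).symm x) =
      chartDeriv p x (lieBracket ℝ (chartField p V) (chartField p W) x) := by
  have hn : minSmoothness ℝ 2 ≤ (∞ : WithTop ℕ∞) := by
    rw [minSmoothness_of_isRCLikeNormedField]
    norm_cast
  have : IsManifold (𝓡 (n + 1)) (minSmoothness ℝ 2) M := IsManifold.of_le hn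
  have h := mpullback_mlieBracket (n := ∞) hV hW (contMDiffAt_chart_symm hx) hn
  rw [← chartDeriv_chartField hx (mlieBracket (𝓡 (n + 1)) V W)]
  congr 1
  refine h.trans ?_
  rw [← mlieBracketWithin_univ, mlieBracketWithin_eq_lieBracketWithin]
  exact congrFun lieBracketWithin_univ x

end Chart

/-! ### Rigid flows and the Levi-Civita connection in a chart -/

section FlowInChart

variable {n : ℕ} {M : Type*} [TopologicalSpace M]
    [ChartedSpace (EuclideanSpace ℝ (Fin (n + 1))) M] [IsManifold (𝓡 (n + 1)) ∞ M]
    [RiemannianBundle (fun x : M => TangentSpace (𝓡 (n + 1)) x)]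

/-- A rigid flow in a chart. -/
theorem IsRigidFlow.exists_isCoordinateRigidFlow {u : ∀ x : M, TangentSpace (𝓡 (n + 1)) x}
    (hu : IsRigidFlow u) {p : M} {x : EuclideanSpace ℝ (Fin (n + 1))}
    (hx : x ∈ (extChartAt (𝓡 (n + 1)) p).target) :
    ∃ (f : EuclideanSpace ℝ (Fin (n + 1)) → EuclideanSpace ℝ (Fin n))
      (h : EuclideanSpace ℝ (Fin n) →
        EuclideanSpace ℝ (Fin n) →L[ℝ] EuclideanSpace ℝ (Fin n) →L[ℝ] ℝ),
      IsCoordinateRigidFlow x (chartMetric p) (chartField p u) f h := by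
  obtain ⟨U, f, V, h, hU, hf⟩ := hu.rigid ((extChartAt (𝓡 (n + 1)) p).symm x)
  have hΦ := (contMDiffAt_chart_symm hx).continuousAt
  have hev : ∀ᶠ y in 𝓝 x, y ∈ (extChartAt (𝓡 (n + 1)) p).target ∧
      (extChartAt (𝓡 (n + 1)) p).symm y ∈ U := by
    filter_upwards [(isOpen_extChartAt_target p).mem_nhds hx,
      hΦ.preimage_mem_nhds (hf.isOpen_source.mem_nhds hU)] with y h1 h2 using ⟨h1, h2⟩
  have hfs : ∀ q ∈ U, ContMDiffAt (𝓡 (n + 1)) (𝓡 n) ∞ f q := fun q hq =>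
    hf.smooth_map.contMDiffAt (hf.isOpen_source.mem_nhds hq)
  have hd : ∀ᶠ y in 𝓝 x, ∀ v, fderiv ℝ (f ∘ (extChartAt (𝓡 (n + 1)) p).symm) y v =
      mvfderiv (𝓡 (n + 1)) f ((extChartAt (𝓡 (n + 1)) p).symm y) (chartDeriv p y v) := by
    filter_upwards [hev] with y hy v
    exact (mvfderiv_chartDeriv hy.1 ((hfs _ hy.2).mdifferentiableAt (by simp)) v).symm
  refine ⟨f ∘ (extChartAt (𝓡 (n + 1)) p).symm, h, contDiffAt_chartField hx hu.smooth.contMDiffAt,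
    ?_, ?_, ?_, ?_, ?_⟩
  · exact ((hfs _ hU).comp x (contMDiffAt_chart_symm hx)).contDiffAt
  · exact hf.smooth_metric.contDiffAt (hf.isOpen_target.mem_nhds (hf.mapsTo hU))
  · filter_upwards [hev] with y hy
    rw [chartMetric_apply, chartDeriv_chartField hy.1, hu.unit]
  · filter_upwards [hev, hd] with y hy hd
    rw [hd, chartDeriv_chartField hy.1, hf.tangent_fibre _ hy.2]
  · filter_upwards [hev, hd] with y hy hd v w
    rw [hd, hd, chartMetric_apply, chartMetric_apply, chartMetric_apply,
      chartDeriv_chartField hy.1]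
    generalize chartDeriv p y v = v
    generalize chartDeriv p y w = w
    have hq := hf.tangent_fibre _ hy.2
    have hi := hf.isometric _ hy.2
    have hu1 := hu.unit ((extChartAt (𝓡 (n + 1)) p).symm y)
    simp only [Function.comp_apply]
    generalize (extChartAt (𝓡 (n + 1)) p).symm y = q at *
    -- The submersion is isometric only on horizontal vectors. Subtracting the flow component does
    -- not change the image and produces the correction term in the metric.
    have horth : ∀ v : TangentSpace (𝓡 (n + 1)) q,
        inner ℝ (u q) (v - inner ℝ (u q) v • u q) = 0 := by
      intro v
      rw [inner_sub_right, inner_smul_right, hu1]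
      ring
    have hmap : ∀ v : TangentSpace (𝓡 (n + 1)) q, mvfderiv (𝓡 (n + 1)) f q
        (v - inner ℝ (u q) v • u q) = mvfderiv (𝓡 (n + 1)) f q v := by
      intro v
      rw [map_sub, map_smul, hq, smul_zero, sub_zero]
    rw [← hmap v, ← hmap w, hi _ _ (horth v) (horth w), inner_sub_left, inner_smul_left, horth,
      inner_sub_right, inner_smul_right, real_inner_comm (u q) v]
    simp
    ring

variable [IsContMDiffRiemannianBundle (𝓡 (n + 1)) ∞ (EuclideanSpace ℝ (Fin (n + 1)))
      (fun x : M => TangentSpace (𝓡 (n + 1)) x)]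

theorem isCoordinateMetric_chartMetric {p : M} {x : EuclideanSpace ℝ (Fin (n + 1))}
    (hx : x ∈ (extChartAt (𝓡 (n + 1)) p).target) : IsCoordinateMetric x (chartMetric p) where
  smooth := contDiffAt_chartMetric hx
  symm := Filter.Eventually.of_forall fun y a b => by
    rw [chartMetric_apply, chartMetric_apply, real_inner_comm]
  pos := by
    filter_upwards [(isOpen_extChartAt_target p).mem_nhds hx] with y hy a ha
    rw [chartMetric_apply]
    refine real_inner_self_pos.2 fun h => ha ?_
    exact (isInvertible_chartDeriv hy).injective (h.trans (map_zero _).symm)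

theorem mdifferentiableAt_inner {p : M} {x : EuclideanSpace ℝ (Fin (n + 1))}
    {Z Y : ∀ x : M, TangentSpace (𝓡 (n + 1)) x}
    (hZ : MDifferentiableAt (𝓡 (n + 1)) (𝓡 (n + 1)).tangent
      (fun x => (⟨x, Z x⟩ : TangentBundle (𝓡 (n + 1)) M)) ((extChartAt (𝓡 (n + 1)) p).symm x))
    (hY : MDifferentiableAt (𝓡 (n + 1)) (𝓡 (n + 1)).tangent
      (fun x => (⟨x, Y x⟩ : TangentBundle (𝓡 (n + 1)) M)) ((extChartAt (𝓡 (n + 1)) p).symm x)) :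
    MDifferentiableAt (𝓡 (n + 1)) 𝓘(ℝ, ℝ) (fun x => inner ℝ (Z x) (Y x))
      ((extChartAt (𝓡 (n + 1)) p).symm x) :=
  MDifferentiableAt.inner_bundle (F := EuclideanSpace ℝ (Fin (n + 1))) hZ hY

/-- The derivative of an inner product of vector fields in a chart. -/
theorem mvfderiv_inner_chart {p : M} {x : EuclideanSpace ℝ (Fin (n + 1))}
    (hx : x ∈ (extChartAt (𝓡 (n + 1)) p).target) {Z Y : ∀ x : M, TangentSpace (𝓡 (n + 1)) x}
    (hZ : ContMDiffAt (𝓡 (n + 1)) (𝓡 (n + 1)).tangent ∞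
      (fun x => (⟨x, Z x⟩ : TangentBundle (𝓡 (n + 1)) M)) ((extChartAt (𝓡 (n + 1)) p).symm x))
    (hY : ContMDiffAt (𝓡 (n + 1)) (𝓡 (n + 1)).tangent ∞
      (fun x => (⟨x, Y x⟩ : TangentBundle (𝓡 (n + 1)) M)) ((extChartAt (𝓡 (n + 1)) p).symm x))
    (a : EuclideanSpace ℝ (Fin (n + 1))) :
    mvfderiv (𝓡 (n + 1)) (fun x => inner ℝ (Z x) (Y x)) ((extChartAt (𝓡 (n + 1)) p).symm x)
      (chartDeriv p x a) =
    fderiv ℝ (chartMetric p) x a (chartField p Z x) (chartField p Y x)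
      + chartMetric p x (fderiv ℝ (chartField p Z) x a) (chartField p Y x)
      + chartMetric p x (chartField p Z x) (fderiv ℝ (chartField p Y) x a) := by
  rw [mvfderiv_chartDeriv hx (mdifferentiableAt_inner (hZ.mdifferentiableAt (by simp))
    (hY.mdifferentiableAt (by simp)))]
  have e : (fun x => inner ℝ (Z x) (Y x)) ∘ (extChartAt (𝓡 (n + 1)) p).symm =ᶠ[𝓝 x]
      fun y => chartMetric p y (chartField p Z y) (chartField p Y y) := by
    filter_upwards [(isOpen_extChartAt_target p).mem_nhds hx] with y hy
    rw [chartMetric_apply, chartDeriv_chartField hy, chartDeriv_chartField hy]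
    rfl
  have d := ((contDiffAt_chartMetric hx).differentiableAt (by simp)).hasFDerivAt.clm_apply
    ((contDiffAt_chartField hx hZ).differentiableAt (by simp)).hasFDerivAt |>.clm_apply
    ((contDiffAt_chartField hx hY).differentiableAt (by simp)).hasFDerivAt
  rw [e.fderiv_eq, d.fderiv]
  simp
  ring

/-- The Levi-Civita connection in a chart. -/
theorem leviCivitaInner_chart {p : M} {x : EuclideanSpace ℝ (Fin (n + 1))}
    (hx : x ∈ (extChartAt (𝓡 (n + 1)) p).target) {Z : ∀ x : M, TangentSpace (𝓡 (n + 1)) x}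
    (hZ : ContMDiffAt (𝓡 (n + 1)) (𝓡 (n + 1)).tangent ∞
      (fun x => (⟨x, Z x⟩ : TangentBundle (𝓡 (n + 1)) M)) ((extChartAt (𝓡 (n + 1)) p).symm x))
    (a b : EuclideanSpace ℝ (Fin (n + 1))) :
    leviCivitaInner Z ((extChartAt (𝓡 (n + 1)) p).symm x) (chartDeriv p x a) (chartDeriv p x b) =
      fderiv ℝ (dualForm (chartMetric p) (chartField p Z)) x a b
        - christoffel (chartMetric p) x (chartField p Z x) a b := by
  have hg := isCoordinateMetric_chartMetric hx
  have hX := FiberBundle.contMDiffAt_extend (k := ∞) (𝓡 (n + 1)) (EuclideanSpace ℝ (Fin (n + 1)))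
    (V := fun x : M => TangentSpace (𝓡 (n + 1)) x) (chartDeriv p x a)
  have hY := FiberBundle.contMDiffAt_extend (k := ∞) (𝓡 (n + 1)) (EuclideanSpace ℝ (Fin (n + 1)))
    (V := fun x : M => TangentSpace (𝓡 (n + 1)) x) (chartDeriv p x b)
  have hXp : FiberBundle.extend (EuclideanSpace ℝ (Fin (n + 1))) (chartDeriv p x a) _ =
    chartDeriv p x a := by simp
  have hYp : FiberBundle.extend (EuclideanSpace ℝ (Fin (n + 1))) (chartDeriv p x b) _ =
    chartDeriv p x b := by simp
  unfold leviCivitaInner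
  generalize FiberBundle.extend (EuclideanSpace ℝ (Fin (n + 1))) (chartDeriv p x a) = X at hX hXp ⊢
  generalize FiberBundle.extend (EuclideanSpace ℝ (Fin (n + 1))) (chartDeriv p x b) = Y at hY hYp ⊢
  have hinj := (isInvertible_chartDeriv hx).injective
  have eX : chartField p X x = a := hinj ((chartDeriv_chartField hx X).trans hXp)
  have eY : chartField p Y x = b := hinj ((chartDeriv_chartField hx Y).trans hYp)
  have dX := hX.mdifferentiableAt (by simp)
  have dY := hY.mdifferentiableAt (by simp)
  have dZ := hZ.mdifferentiableAt (by simp)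
  simp only
  rw [mlieBracket_chart hx dX dZ, mlieBracket_chart hx dZ dY, mlieBracket_chart hx dX dY,
    ← chartDeriv_chartField hx Z, mvfderiv_inner_chart hx hZ hY, mvfderiv_inner_chart hx hX hY,
    mvfderiv_inner_chart hx hX hZ, ← chartMetric_apply, ← chartMetric_apply, ← chartMetric_apply,
    (IsCoordinateRigidFlow.fderiv_dualForm hg (contDiffAt_chartField hx hZ)).self_of_nhds,
    christoffel_apply]
  simp only [lieBracket, eX, eY, map_sub, _root_.sub_apply]
  have hs := hg.symm.self_of_nhds
  have hs' := (IsCoordinateRigidFlow.fderiv_symm hg).self_of_nhds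
  -- After normalising by symmetry, the derivatives of the extensions `X` and `Y` cancel between the
  -- product rule and the brackets.
  rw [hs (fderiv ℝ (chartField p Y) x _) a, hs (fderiv ℝ (chartField p Z) x b) a,
    hs (fderiv ℝ (chartField p X) x b), hs (fderiv ℝ (chartField p Y) x a), hs' b a]
  ring

/-- The connection form of a rigid flow in a chart. -/
theorem IsRigidFlow.leviCivitaInner_chart {u : ∀ x : M, TangentSpace (𝓡 (n + 1)) x}
    (hu : IsRigidFlow u) {p : M} {x : EuclideanSpace ℝ (Fin (n + 1))}
    (hx : x ∈ (extChartAt (𝓡 (n + 1)) p).target) (a b : EuclideanSpace ℝ (Fin (n + 1))) :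
    leviCivitaInner u ((extChartAt (𝓡 (n + 1)) p).symm x) (chartDeriv p x a) (chartDeriv p x b) =
      vorticityForm (chartMetric p) (chartField p u) x a b
      + dualForm (chartMetric p) (chartField p u) x a *
        accelerationForm (chartMetric p) (chartField p u) x b := by
  obtain ⟨f, h, hc⟩ := hu.exists_isCoordinateRigidFlow hx
  rw [_root_.leviCivitaInner_chart hx hu.smooth.contMDiffAt,
    (hc.fderiv_dualForm_eq (isCoordinateMetric_chartMetric hx)).self_of_nhds]
  ring

end FlowInChart

/-! ### Propagation of agreement of rigid flows -/

/-- The vorticity form of a flow annihilates its velocity in either slot at a point where the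
velocity has unit length, so horizontal arguments suffice. `SameFlowM` compares only those. -/
theorem vorticityForm_eq_of_horizontal {E : Type*} [NormedAddCommGroup E] [NormedSpace ℝ E]
    {g : E → E →L[ℝ] E →L[ℝ] ℝ} {u u' : E → E} {x : E} (hu : g x (u x) (u x) = 1)
    (h0 : u x = u' x) (h : ∀ a b, g x (u x) a = 0 → g x (u x) b = 0 →
      vorticityForm g u x a b = vorticityForm g u' x a b) :
    vorticityForm g u x = vorticityForm g u' x := by
  have hl : ∀ v : E → E, g x (v x) (v x) = 1 → ∀ b, vorticityForm g v x (v x) b = 0 := by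
    intro v hv b
    have hv' : dualForm g v x (v x) = 1 := hv
    rw [vorticityForm_apply, hv', accelerationForm_apply, accelerationForm_apply]
    ring
  have hr : ∀ v : E → E, g x (v x) (v x) = 1 → ∀ b, vorticityForm g v x b (v x) = 0 := by
    intro v hv b
    have hv' : dualForm g v x (v x) = 1 := hv
    rw [vorticityForm_apply, hv', accelerationForm_apply, accelerationForm_apply]
    ring
  have hu' : g x (u' x) (u' x) = 1 := by rw [← h0, hu]
  ext a b
  have := h (a - g x (u x) a • u x) (b - g x (u x) b • u x) (by simp [hu]) (by simp [hu])
  have l := hl u' hu'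
  have r := hr u' hu'
  rw [← h0] at l r
  simpa [hl u hu, hr u hu, l, r] using this

section Flow

variable {n : ℕ} {M : Type*} [TopologicalSpace M]
    [ChartedSpace (EuclideanSpace ℝ (Fin (n + 1))) M] [IsManifold (𝓡 (n + 1)) ∞ M]

theorem chartField_eq_iff {p : M} {x : EuclideanSpace ℝ (Fin (n + 1))}
    (hx : x ∈ (extChartAt (𝓡 (n + 1)) p).target) {Z Z' : ∀ x : M, TangentSpace (𝓡 (n + 1)) x} :
    chartField p Z x = chartField p Z' x ↔
      Z ((extChartAt (𝓡 (n + 1)) p).symm x) = Z' ((extChartAt (𝓡 (n + 1)) p).symm x) := by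
  rw [← chartDeriv_chartField hx Z, ← chartDeriv_chartField hx Z']
  exact (isInvertible_chartDeriv hx).injective.eq_iff.symm

variable [RiemannianBundle (fun x : M => TangentSpace (𝓡 (n + 1)) x)]

/-- The tensors `M` and `K` only depend on the germ of the flow. -/
theorem leviCivitaInner_congr {u u' : ∀ x : M, TangentSpace (𝓡 (n + 1)) x} {p : M}
    (h : ∀ᶠ q in 𝓝 p, u q = u' q) (v w : TangentSpace (𝓡 (n + 1)) p) :
    leviCivitaInner u p v w = leviCivitaInner u' p v w := by
  have hZ : ∀ Y : ∀ x : M, TangentSpace (𝓡 (n + 1)) x,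
      mvfderiv (𝓡 (n + 1)) (fun x => inner ℝ (u x) (Y x)) p =
        mvfderiv (𝓡 (n + 1)) (fun x => inner ℝ (u' x) (Y x)) p := fun Y =>
    Filter.EventuallyEq.mfderiv_eq (h.mono fun q hq => by simp only [hq])
  have hZ' : ∀ Y : ∀ x : M, TangentSpace (𝓡 (n + 1)) x,
      mvfderiv (𝓡 (n + 1)) (fun x => inner ℝ (Y x) (u x)) p =
        mvfderiv (𝓡 (n + 1)) (fun x => inner ℝ (Y x) (u' x)) p := fun Y =>
    Filter.EventuallyEq.mfderiv_eq (h.mono fun q hq => by simp only [hq])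
  have hl : ∀ Y : ∀ x : M, TangentSpace (𝓡 (n + 1)) x,
      mlieBracket (𝓡 (n + 1)) u Y p = mlieBracket (𝓡 (n + 1)) u' Y p := fun Y =>
    Filter.EventuallyEq.mlieBracket_vectorField_eq h (Filter.EventuallyEq.refl _ _)
  have hr : ∀ Y : ∀ x : M, TangentSpace (𝓡 (n + 1)) x,
      mlieBracket (𝓡 (n + 1)) Y u p = mlieBracket (𝓡 (n + 1)) Y u' p := fun Y =>
    Filter.EventuallyEq.mlieBracket_vectorField_eq (Filter.EventuallyEq.refl _ _) h
  simp only [leviCivitaInner, hZ, hZ', hl, hr, h.self_of_nhds]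

theorem sameFlowM_of_eventually_eq {u u' : ∀ x : M, TangentSpace (𝓡 (n + 1)) x} {S : Set M}
    (h : ∀ p ∈ S, ∀ᶠ q in 𝓝 p, u q = u' q) :
    SameFlowM u u' S := fun p hp => ⟨(h p hp).self_of_nhds, fun v w _ _ => by
  rw [flowM, flowM, leviCivitaInner_congr (h p hp)]⟩

theorem sameFlowK_of_eventually_eq {u u' : ∀ x : M, TangentSpace (𝓡 (n + 1)) x} {S : Set M}
    (h : ∀ p ∈ S, ∀ᶠ q in 𝓝 p, u q = u' q) :
    SameFlowK u u' S := fun p hp => ⟨(h p hp).self_of_nhds, fun v _ => by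
  rw [flowK, flowK, leviCivitaInner_congr (h p hp), (h p hp).self_of_nhds]⟩

variable [IsContMDiffRiemannianBundle (𝓡 (n + 1)) ∞ (EuclideanSpace ℝ (Fin (n + 1)))
      (fun x : M => TangentSpace (𝓡 (n + 1)) x)]
  {u u' : ∀ x : M, TangentSpace (𝓡 (n + 1)) x}

/-- The tensor `M` is the vorticity. -/
theorem IsRigidFlow.flowM_chart (hu : IsRigidFlow u) {p : M}
    {x : EuclideanSpace ℝ (Fin (n + 1))} (hx : x ∈ (extChartAt (𝓡 (n + 1)) p).target)
    {a b : EuclideanSpace ℝ (Fin (n + 1))}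
    (hb : inner ℝ (u ((extChartAt (𝓡 (n + 1)) p).symm x)) (chartDeriv p x b) = 0) :
    flowM u ((extChartAt (𝓡 (n + 1)) p).symm x) (chartDeriv p x a) (chartDeriv p x b) =
      -vorticityForm (chartMetric p) (chartField p u) x b a := by
  have : dualForm (chartMetric p) (chartField p u) x b = 0 := by
    rw [dualForm, chartMetric_apply, chartDeriv_chartField hx, hb]
  rw [flowM, hu.leviCivitaInner_chart hx, this]
  ring

theorem IsRigidFlow.exists_vorticityForm_ne_zero (hu : IsRigidFlow u) {p : M}
    {x : EuclideanSpace ℝ (Fin (n + 1))} (hx : x ∈ (extChartAt (𝓡 (n + 1)) p).target)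
    (hM : FlowMNeZeroAt u ((extChartAt (𝓡 (n + 1)) p).symm x)) :
    ∃ a b, vorticityForm (chartMetric p) (chartField p u) x a b ≠ 0 := by
  obtain ⟨v, w, -, hw, h⟩ := hM
  obtain ⟨a, rfl⟩ := (isInvertible_chartDeriv hx).surjective v
  obtain ⟨b, rfl⟩ := (isInvertible_chartDeriv hx).surjective w
  rw [hu.flowM_chart hx hw] at h
  exact ⟨b, a, neg_ne_zero.1 h⟩

theorem SameFlowM.vorticityForm_eq {S : Set M} (hM : SameFlowM u u' S) (hu : IsRigidFlow u)
    (hu' : IsRigidFlow u') {p : M} {x : EuclideanSpace ℝ (Fin (n + 1))}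
    (hx : x ∈ (extChartAt (𝓡 (n + 1)) p).target)
    (hS : (extChartAt (𝓡 (n + 1)) p).symm x ∈ S) :
    chartField p u x = chartField p u' x ∧ vorticityForm (chartMetric p) (chartField p u) x =
      vorticityForm (chartMetric p) (chartField p u') x := by
  obtain ⟨h0, h⟩ := hM _ hS
  have h1 := (chartField_eq_iff hx).2 h0
  refine ⟨h1, vorticityForm_eq_of_horizontal ?_ h1 fun a b ha hb => ?_⟩
  · rw [chartMetric_apply, chartDeriv_chartField hx, hu.unit]
  · rw [chartMetric_apply, chartDeriv_chartField hx] at ha hb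
    have := h _ _ hb ha
    rw [hu.flowM_chart hx ha, hu'.flowM_chart hx (by rwa [← h0])] at this
    exact neg_injective this

/-- Rigid flows with the same first derivatives at a point agree near that point. -/
theorem IsRigidFlow.eventually_eq (hu : IsRigidFlow u) (hu' : IsRigidFlow u') {p : M}
    (hM : FlowMNeZeroAt u p)
    (h0 : chartField p u (extChartAt (𝓡 (n + 1)) p p) =
      chartField p u' (extChartAt (𝓡 (n + 1)) p p))
    (h1 : fderiv ℝ (chartField p u) (extChartAt (𝓡 (n + 1)) p p) =
      fderiv ℝ (chartField p u') (extChartAt (𝓡 (n + 1)) p p)) :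
    ∀ᶠ q in 𝓝 p, u q = u' q := by
  have hx := mem_extChartAt_target (I := 𝓡 (n + 1)) p
  obtain ⟨f, h, hc⟩ := hu.exists_isCoordinateRigidFlow hx
  obtain ⟨f', h', hc'⟩ := hu'.exists_isCoordinateRigidFlow hx
  have := hc.eventually_eq hc' (isCoordinateMetric_chartMetric hx) h0 h1
    (hu.exists_vorticityForm_ne_zero hx (by rwa [extChartAt_to_inv]))
  filter_upwards [(continuousAt_extChartAt p).eventually this,
    extChartAt_source_mem_nhds (I := 𝓡 (n + 1)) p] with q hq hs
  rw [chartField_eq_iff ((extChartAt (𝓡 (n + 1)) p).map_source hs)] at hq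
  rwa [(extChartAt (𝓡 (n + 1)) p).left_inv hs] at hq

/-- The set near whose points two rigid flows agree is closed in the region of nonzero vorticity. -/
theorem IsRigidFlow.eventually_eq_of_frequently (hu : IsRigidFlow u) (hu' : IsRigidFlow u') {p : M}
    (hM : FlowMNeZeroAt u p) (h : ∃ᶠ q in 𝓝 p, ∀ᶠ r in 𝓝 q, u r = u' r) :
    ∀ᶠ q in 𝓝 p, u q = u' q := by
  have hx := mem_extChartAt_target (I := 𝓡 (n + 1)) p
  have hf : ∃ᶠ y in 𝓝 (extChartAt (𝓡 (n + 1)) p p), chartField p u =ᶠ[𝓝 y] chartField p u' := by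
    refine (continuousAt_extChartAt (I := 𝓡 (n + 1)) p).tendsto.frequently ?_
    refine (h.and_eventually (extChartAt_source_mem_nhds (I := 𝓡 (n + 1)) p)).mono ?_
    rintro q ⟨hq, hs⟩
    have ht := (extChartAt (𝓡 (n + 1)) p).map_source hs
    rw [← (extChartAt (𝓡 (n + 1)) p).left_inv hs] at hq
    filter_upwards [(contMDiffAt_chart_symm ht).continuousAt.eventually hq,
      (isOpen_extChartAt_target p).mem_nhds ht] with y h1 h2
    exact (chartField_eq_iff h2).2 h1
  have hc := contDiffAt_chartField hx hu.smooth.contMDiffAt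
  have hc' := contDiffAt_chartField hx hu'.smooth.contMDiffAt
  -- At points near which the flows agree, both the fields and their derivatives coincide;
  -- continuity carries this 1-jet to the limit point `p`.
  exact hu.eventually_eq hu' hM
    (tendsto_nhds_unique_of_frequently_eq hc.continuousAt hc'.continuousAt
      (hf.mono fun y e => e.self_of_nhds))
    (tendsto_nhds_unique_of_frequently_eq (Controlled.fderiv_smooth hc).continuousAt
      (Controlled.fderiv_smooth hc').continuousAt (hf.mono fun y e => e.fderiv_eq))

/-- Rigid flows with the same tensor `M` over a transversal hypersurface agree near its points with
nonzero vorticity. -/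
theorem IsRigidFlow.eventually_eq_of_hypersurface (hu : IsRigidFlow u) (hu' : IsRigidFlow u')
    {T : Set M} (hT : IsHypersurface (n := n) T) (hTu : IsTransversalTo T u)
    (hST : SameFlowM u u' T) {p : M} (hp : p ∈ T) (hM : FlowMNeZeroAt u p) :
    ∀ᶠ q in 𝓝 p, u q = u' q := by
  have hx := mem_extChartAt_target (I := 𝓡 (n + 1)) p
  have hxp := extChartAt_to_inv (I := 𝓡 (n + 1)) p
  obtain ⟨U, φ, hU, hφ⟩ := hT p hp
  have htr := hTu p hp U φ hU hφ
  have hφp := (hφ.eq_zero_iff p hU).1 hp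
  have hφs := hφ.smooth.contMDiffAt (hφ.isOpen.mem_nhds hU)
  have hUn := hφ.isOpen.mem_nhds hU
  rw [← hxp] at htr hφs hφp hUn
  obtain ⟨f, h, hc⟩ := hu.exists_isCoordinateRigidFlow hx
  obtain ⟨f', h', hc'⟩ := hu'.exists_isCoordinateRigidFlow hx
  refine hu.eventually_eq hu' hM (hST.vorticityForm_eq hu hu' hx (by rwa [hxp])).1 ?_
  refine hc.fderiv_eq_of_hypersurface hc' (isCoordinateMetric_chartMetric hx)
    (φ := φ ∘ (extChartAt (𝓡 (n + 1)) p).symm)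
    (hφs.comp _ (contMDiffAt_chart_symm hx)).contDiffAt hφp ?_ ?_
    (hu.exists_vorticityForm_ne_zero hx (by rwa [hxp]))
  · filter_upwards [(contMDiffAt_chart_symm hx).continuousAt.eventually hUn,
      (isOpen_extChartAt_target p).mem_nhds hx] with y hy ht h0
    exact hST.vorticityForm_eq hu hu' ht ((hφ.eq_zero_iff _ hy).2 h0)
  · rwa [← mvfderiv_chartDeriv hx (hφs.mdifferentiableAt (by simp)), chartDeriv_chartField hx]

/-- Rigid flows with the same tensor `M` over a transversal hypersurface agree on every open set of
nonzero vorticity all of whose components meet the hypersurface. -/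
theorem IsRigidFlow.eventually_eq_of_mem (hu : IsRigidFlow u) (hu' : IsRigidFlow u')
    {T : Set M} (hT : IsHypersurface (n := n) T) (hTu : IsTransversalTo T u)
    (hST : SameFlowM u u' T) {O : Set M} (hM : ∀ p ∈ O, FlowMNeZeroAt u p)
    (hO : ∀ p ∈ O, (connectedComponentIn O p ∩ T).Nonempty) {p : M} (hp : p ∈ O) :
    ∀ᶠ q in 𝓝 p, u q = u' q := by
  have hsub := connectedComponentIn_subset O p
  obtain ⟨t, htO, htT⟩ := hO p hp
  -- Connectedness is applied to the set of points near which the flows agree: it is open, meets the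
  -- component at `t`, and contains its limit points lying in the component.
  have := isPreconnected_connectedComponentIn.subset_of_closure_inter_subset
    (u := {q : M | ∀ᶠ r in 𝓝 q, u r = u' r}) isOpen_setOfPred_eventually_nhds
    ⟨t, htO, hu.eventually_eq_of_hypersurface hu' hT hTu hST htT (hM t (hsub htO))⟩
    fun q hq => hu.eventually_eq_of_frequently hu' (hM q (hsub hq.2))
      (mem_closure_iff_frequently.1 hq.1)
  exact this (mem_connectedComponentIn hp)

end Flow

end

theorem mainTheorem4 {n : ℕ} {M : Type*} [TopologicalSpace M] [T2Space M]
    [SecondCountableTopology M]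
    [ChartedSpace (EuclideanSpace ℝ (Fin (n + 1))) M] [IsManifold (𝓡 (n + 1)) ∞ M]
    [RiemannianBundle (fun x : M => TangentSpace (𝓡 (n + 1)) x)]
    [IsContMDiffRiemannianBundle (𝓡 (n + 1)) ∞ (EuclideanSpace ℝ (Fin (n + 1)))
      (fun x : M => TangentSpace (𝓡 (n + 1)) x)]
    (u u' : ∀ x : M, TangentSpace (𝓡 (n + 1)) x) (hu : IsRigidFlow u) (hu' : IsRigidFlow u')
    (T : Set M) (hT : IsHypersurface (n := n) T)
    (hTu : IsTransversalTo T u) (hTu' : IsTransversalTo T u')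
    (hM : SameFlowM u u' T) :
    ((∀ p, FlowMNeZeroAt u p) → (∀ p : M, (connectedComponent p ∩ T).Nonempty) →
      SameFlowM u u' Set.univ) ∧
    (∀ O : Set M, IsOpen O → T ⊆ O → (∀ p ∈ O, FlowMNeZeroAt u p) →
      (∀ p ∈ O, (connectedComponentIn O p ∩ T).Nonempty) →
      SameFlowM u u' O ∧ SameFlowK u u' O) := by
  have key {O : Set M} (h0 : ∀ p ∈ O, FlowMNeZeroAt u p)
      (hO : ∀ p ∈ O, (connectedComponentIn O p ∩ T).Nonempty) :
      ∀ p ∈ O, ∀ᶠ q in 𝓝 p, u q = u' q := fun p hp =>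
    hu.eventually_eq_of_mem hu' hT hTu hM h0 hO hp
  refine ⟨fun h0 hc => ?_, fun O _ _ h0 hc => ?_⟩
  · refine sameFlowM_of_eventually_eq (key (fun p _ => h0 p) fun p _ => ?_)
    rw [connectedComponentIn_univ]
    exact hc p
  · exact ⟨sameFlowM_of_eventually_eq (key h0 hc), sameFlowK_of_eventually_eq (key h0 hc)⟩
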